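/- Let $k\ge 2$ and $\kappa_0>0$. For $\kappa>0$ and $\theta\in\mathcal S^{k-1}=\{v\in\mathbb R^k:\|v\|=1\}$ let $\mathrm P^{(n)}_{(\kappa,\theta)}$ be the joint law of $n$ i.i.d. observations $X_1,\dots,X_n$ on $\mathcal S^{k-1}$ from the Fisher--von Mises--Langevin distribution, whose density with respect to the surface area measure is proportional to $x\mapsto\exp(\kappa x'\theta)$. Put $$A_k(\kappa)=\frac{\int_{-1}^1 t\,e^{\kappa t}(1-t^2)^{(k-3)/2}\,dt}{\int_{-1}^1 e^{\kappa t}(1-t^2)^{(k-3)/2}\,dt},\qquad \Gamma=1-\frac{k-1}{\kappa_0}A_k(\kappa_0)-A_k(\kappa_0)^2 .$$ Let $\hat\theta^{(n)}=\hat\theta^{(n)}(X_1,\dots,X_n)\in\mathcal S^{k-1}$ be a root-$n$ consistent estimator of $\theta$, i.e. $n^{1/2}(\hat\theta^{(n)}-\theta)=O_{\mathrm P}(1)$ under $\mathrm P^{(n)}_{(\kappa_0,\theta)}$ for every $\theta\in\mathcal S^{k-1}$, and let $$Q^{(n)}_{\kappa_0}=\frac{\bigl(\sum_{i=1}^n (X_i'\hat\theta^{(n)}-A_k(\kappa_0))\bigr)^2}{n\,\Gamma}.$$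 Then: (i) for every $\theta\in\mathcal S^{k-1}$, $Q^{(n)}_{\kappa_0}$ converges in distribution to a $\chi^2_1$ variable under $\mathrm P^{(n)}_{(\kappa_0,\theta)}$; (ii) for every $\theta\in\mathcal S^{k-1}$ and every real sequence $c^{(n)}\to c$ with $\kappa_0+n^{-1/2}c^{(n)}>0$ for all $n$, $Q^{(n)}_{\kappa_0}$ converges in distribution under $\mathrm P^{(n)}_{(\kappa_0+n^{-1/2}c^{(n)},\theta)}$ to a non-central $\chi^2_1$ variable with non-centrality parameter $\Gamma c^2$; (iii) for $0<\alpha<1$ let $\phi^{(n)}$ be the test that rejects $\kappa=\kappa_0$ when $Q^{(n)}_{\kappa_0}$ exceeds the $\alpha$-upper quantile of $\chi^2_1$. For nonempty $\Theta\subseteq\mathcal S^{k-1}$ call a sequence of tests $\phi^{(n)}$ locally and asymptotically maximin over $\Theta$ at level $\alpha$ if $\mathrm E_{\mathrm P^{(n)}_{(\kappa_0,\theta)}}[\phi^{(n)}]\to\alpha$ uniformly in $\theta\in\Theta$ and, for all $0<b\le M$ and every sequence of (possibly randomized) tests $\psi^{(n)}$ with $\limsup_n\sup_{\theta\in\Theta}\mathrm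 E_{\mathrm P^{(n)}_{(\kappa_0,\theta)}}[\psi^{(n)}]\le\alpha$, $$\liminf_{n\to\infty}\ \inf_{\mathrm P\in\mathcal H_1^{(n)}}\mathrm E_{\mathrm P}[\phi^{(n)}]\ \ge\ \limsup_{n\to\infty}\ \inf_{\mathrm P\in\mathcal H_1^{(n)}}\mathrm E_{\mathrm P}[\psi^{(n)}],$$ $$\mathcal H_1^{(n)}=\bigl\{\mathrm P^{(n)}_{(\kappa_0+n^{-1/2}c,\theta)}:\theta\in\Theta,\ b\le|c|\le M,\ \kappa_0+n^{-1/2}c>0\bigr\}.$$ Then $\phi^{(n)}$ is locally and asymptotically maximin at level $\alpha$ over $\{\theta\}$ for every $\theta\in\mathcal S^{k-1}$; and if $n^{1/2}(\hat\theta^{(n)}-\theta)=O_{\mathrm P}(1)$ under $\mathrm P^{(n)}_{(\kappa_0,\theta)}$ holds uniformly in $\theta\in\mathcal S^{k-1}$, then it is locally and asymptotically maximin at level $\alpha$ over the whole of $\mathcal S^{k-1}$. -/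

import Mathlib

open MeasureTheory ProbabilityTheory Filter Topology
open scoped InnerProductSpace

namespace FvML

/-- The unit sphere `S^{k-1}` of `ℝ^k`. -/
abbrev Sph (k : ℕ) : Type := Metric.sphere (0 : EuclideanSpace ℝ (Fin k)) 1

/-- The surface area measure on `S^{k-1}`. -/
noncomputable def surface (k : ℕ) : Measure (Sph k) :=
  (volume : Measure (EuclideanSpace ℝ (Fin k))).toSphere

/-- The Fisher-von Mises-Langevin distribution with concentration `κ` and location `θ`: the
probability measure on the sphere whose density with respect to the surface area measure is
`x ↦ exp (κ x'θ) / ∫ exp (κ y'θ) dσ(y)`. -/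
noncomputable def fvml {k : ℕ} (κ : ℝ) (θ : Sph k) : Measure (Sph k) :=
  (surface k).tilted fun x => κ * ⟪(x : EuclideanSpace ℝ (Fin k)), (θ : EuclideanSpace ℝ (Fin k))⟫_ℝ

instance isProbabilityMeasure_fvml {k : ℕ} (κ : ℝ) (θ : Sph k) :
    IsProbabilityMeasure (fvml κ θ) := by
  have hnt : Nontrivial (EuclideanSpace ℝ (Fin k)) :=
    ⟨⟨θ, 0, fun h => by
      have h1 : ‖(θ : EuclideanSpace ℝ (Fin k))‖ = 1 := by simp
      rw [h] at h1
      simp at h1⟩⟩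
  have : IsFiniteMeasure (surface k) := by unfold surface; infer_instance
  have : NeZero (surface k) := ⟨by unfold surface; exact Measure.toSphere_ne_zero _⟩
  refine isProbabilityMeasure_tilted ?_
  have hc : Continuous fun x : Sph k =>
      Real.exp (κ * ⟪(x : EuclideanSpace ℝ (Fin k)), (θ : EuclideanSpace ℝ (Fin k))⟫_ℝ) := by
    fun_prop
  rw [← integrableOn_univ]
  exact hc.continuousOn.integrableOn_compact isCompact_univ

/-- The joint law of `n` i.i.d. observations from the FvML distribution. -/
noncomputable def sampleLaw {k : ℕ} (κ : ℝ) (θ : Sph k) (n : ℕ) : Measure (Fin n → Sph k) :=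
  Measure.pi fun _ => fvml κ θ

instance isProbabilityMeasure_sampleLaw {k : ℕ} (κ : ℝ) (θ : Sph k) (n : ℕ) :
    IsProbabilityMeasure (sampleLaw κ θ n) := by
  unfold sampleLaw; infer_instance

/-- `A_k(κ) = ∫ t e^{κt} (1-t²)^{(k-3)/2} dt / ∫ e^{κt} (1-t²)^{(k-3)/2} dt` over `[-1, 1]`. -/
noncomputable def A (k : ℕ) (κ : ℝ) : ℝ :=
  (∫ t in (-1 : ℝ)..1, t * Real.exp (κ * t) * (1 - t ^ 2) ^ (((k : ℝ) - 3) / 2)) /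
    ∫ t in (-1 : ℝ)..1, Real.exp (κ * t) * (1 - t ^ 2) ^ (((k : ℝ) - 3) / 2)

/-- The Fisher information for the concentration, `1 - (k-1) A_k(κ)/κ - A_k(κ)²`. -/
noncomputable def info (k : ℕ) (κ : ℝ) : ℝ :=
  1 - ((k : ℝ) - 1) / κ * A k κ - A k κ ^ 2

/-- The one-sample score statistic, with the location replaced by the estimator `est`. -/
noncomputable def scoreStat {k : ℕ} (κ₀ : ℝ) (est : ∀ n : ℕ, (Fin n → Sph k) → Sph k)
    (n : ℕ) (x : Fin n → Sph k) : ℝ :=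
  (∑ i, (⟪(x i : EuclideanSpace ℝ (Fin k)), (est n x : EuclideanSpace ℝ (Fin k))⟫_ℝ - A k κ₀)) ^ 2 /
    (n * info k κ₀)

/-- The estimator `est` is root-`n` consistent at concentration `κ₀`, uniformly over the locations
in `Θ`: `√n (est - θ) = O_P(1)` under `P_{(κ₀, θ)}`, uniformly in `θ ∈ Θ`. For `Θ = {θ}` this is the
usual root-`n` consistency under `P_{(κ₀, θ)}`. -/
def RootNConsistentOn {k : ℕ} (κ₀ : ℝ) (Θ : Set (Sph k))
    (est : ∀ n : ℕ, (Fin n → Sph k) → Sph k) : Prop :=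
  ∀ ε > 0, ∃ C : ℝ, ∀ᶠ n : ℕ in atTop, ∀ θ ∈ Θ,
    (sampleLaw κ₀ θ n).real
      {x | C < √n * ‖(est n x : EuclideanSpace ℝ (Fin k)) - (θ : EuclideanSpace ℝ (Fin k))‖} ≤ ε

/-- The chi-square distribution with one degree of freedom and non-centrality `lam ≥ 0`: the law of
`Z²` with `Z` normal of mean `√lam` and variance `1`. It is central for `lam = 0`. -/
noncomputable def chiSqOne (lam : ℝ) : Measure ℝ :=
  (gaussianReal (√lam) 1).map fun z => z ^ 2

instance isProbabilityMeasure_chiSqOne (lam : ℝ) : IsProbabilityMeasure (chiSqOne lam) :=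
  Measure.isProbabilityMeasure_map (by fun_prop)

/-- The `α`-upper quantile (quantile of order `1 - α`) of a distribution on `ℝ`. -/
noncomputable def upperQuantile (μ : Measure ℝ) (α : ℝ) : ℝ :=
  sInf {x : ℝ | 1 - α ≤ cdf μ x}

/-- The test that rejects when the score statistic exceeds the `α`-upper quantile of the central
chi-square distribution with one degree of freedom. -/
noncomputable def scoreTest {k : ℕ} (κ₀ : ℝ) (est : ∀ n : ℕ, (Fin n → Sph k) → Sph k) (α : ℝ)
    (n : ℕ) : (Fin n → Sph k) → ℝ :=
  Set.indicator {x | upperQuantile (chiSqOne 0) α < scoreStat κ₀ est n x} fun _ => 1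

/-- A sequence of (possibly randomized) tests, given by critical functions. -/
def IsTestSeq {k : ℕ} (φ : ∀ n : ℕ, (Fin n → Sph k) → ℝ) : Prop :=
  ∀ n, Measurable (φ n) ∧ ∀ x, φ n x ∈ Set.Icc (0 : ℝ) 1

/-- The probability `E[φ]` that the `n`-th test rejects under `P_{(κ, θ)}`. -/
noncomputable def power {k : ℕ} (φ : ∀ n : ℕ, (Fin n → Sph k) → ℝ) (κ : ℝ) (θ : Sph k) (n : ℕ) :
    ℝ :=
  ∫ x, φ n x ∂(sampleLaw κ θ n)

/-- Membership in the class of tests of asymptotic level (at most) `α` for the null hypothesis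
`{P_{(κ₀, θ)} : θ ∈ Θ}`: `limsup_n sup_{θ ∈ Θ} E_{(κ₀, θ)}[φ] ≤ α`. -/
def HasAsympLevelLE {k : ℕ} (κ₀ : ℝ) (Θ : Set (Sph k)) (α : ℝ)
    (φ : ∀ n : ℕ, (Fin n → Sph k) → ℝ) : Prop :=
  IsTestSeq φ ∧ ∀ ε > 0, ∀ᶠ n : ℕ in atTop, ∀ θ ∈ Θ, power φ κ₀ θ n ≤ α + ε

/-- The smallest power at sample size `n` over the two-sided local alternatives
`P_{(κ₀ + n^{-1/2} c, θ)}` with `θ ∈ Θ`, `b ≤ |c| ≤ M` and `κ₀ + n^{-1/2} c > 0`. -/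
noncomputable def minPower {k : ℕ} (κ₀ : ℝ) (Θ : Set (Sph k)) (b M : ℝ)
    (φ : ∀ n : ℕ, (Fin n → Sph k) → ℝ) (n : ℕ) : ℝ :=
  sInf {p : ℝ | ∃ θ ∈ Θ, ∃ c : ℝ, b ≤ |c| ∧ |c| ≤ M ∧ 0 < κ₀ + c / √n ∧
    p = power φ (κ₀ + c / √n) θ n}

/-- The sequence `φ` is locally and asymptotically maximin at asymptotic level `α` for the null
hypothesis `κ = κ₀` against two-sided local alternatives, locations ranging over `Θ`: it has
asymptotic level `α`, and asymptotically no test of asymptotic level `α` has a larger minimum power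
over the alternatives at local distance between `b` and `M`, whatever `0 < b ≤ M`. -/
structure IsLocAsympMaximin {k : ℕ} (κ₀ : ℝ) (Θ : Set (Sph k)) (α : ℝ)
    (φ : ∀ n : ℕ, (Fin n → Sph k) → ℝ) : Prop where
  isTestSeq : IsTestSeq φ
  level : ∀ ε > 0, ∀ᶠ n : ℕ in atTop, ∀ θ ∈ Θ, |power φ κ₀ θ n - α| ≤ ε
  maximin : ∀ b M : ℝ, 0 < b → b ≤ M →
    ∀ ψ : ∀ n : ℕ, (Fin n → Sph k) → ℝ, HasAsympLevelLE κ₀ Θ α ψ →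
      limsup (minPower κ₀ Θ b M ψ) atTop ≤ liminf (minPower κ₀ Θ b M φ) atTop

end FvML

/-! In the concentration parameter the FvML laws form a one-parameter exponential family: passing
from `κ₀` to `κ₀ + c/√n` tilts the sample law by `exp (c S_n/√n)`, where `S_n` is the centred sum of
the coordinates `X_i'θ`. Everything therefore follows from the moment generating function of one
coordinate.

Under the surface measure the coordinate has density proportional to `(1 - t²)^{(k-3)/2}`. This
gives mean `A_k(κ₀)` and, by an integration by parts, variance `Γ`. A Taylor bound on the centred
moment generating function, with a constant independent of `θ`, gives `E exp (z S_n/√n) → exp (Γ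
z²/2)` for complex `z`. Taking `z = c + it` and dividing by the value at `z = c` yields the limit
`N(cΓ, Γ)` under local alternatives (`tendsto_charFun_score`). Real `z` bounds the second moment of
the likelihood ratio, hence gives contiguity (`tendsto_integral_local_of_null`).

Estimating `θ` costs nothing, because both vectors are unit. By `score_sub_score` the change in
`S_n` is the centred vector sum paired with `est - θ`, plus a term of order `n‖est - θ‖²`. Both are
`O_P(1)` and vanish after division by `√n`. Contiguity carries this to the alternatives, and
squaring gives the chi-square limits.

For optimality, the power of the score test converges to `limitPower`, uniformly over compact sets
of `c` and over `Θ`, and `limitPower` increases with `|c|`; so its minimum power tends to at least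
the value at `b` (`eventually_power_scoreTest`, `limitPower_mono`). Conversely, the minimum power of
any test is at most its average power at `±b` at a single location. The averaged likelihood ratio is
nearly a multiple of `cosh (b S_n/√n)`, increasing in `|S_n|`, so by Neyman-Pearson the score test
at known location is nearly best, with the same limiting power (`eventually_minPower_le`).

Uniformity in `θ` is obtained by proving limits along arbitrary sequences of sample sizes `N j → ∞`,
locations `θ j` and parameters `c j → c₀`. -/

namespace FvML

open scoped ENNReal

/-! ### Polar coordinates and the projection of the surface measure on an axis. -/

/-- Integration in polar coordinates, for nonnegative functions. -/
lemma lintegral_eq_lintegral_toSphere {E : Type*} [NormedAddCommGroup E] [NormedSpace ℝ E]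
    [FiniteDimensional ℝ E] [MeasurableSpace E] [BorelSpace E] [Nontrivial E] (μ : Measure E)
    [μ.IsAddHaarMeasure] {F : E → ℝ≥0∞} (hF : Measurable F) :
    ∫⁻ y, F y ∂μ = ∫⁻ x, (∫⁻ r in Set.Ioi (0 : ℝ),
      ENNReal.ofReal (r ^ (Module.finrank ℝ E - 1)) * F (r • (x : E))) ∂μ.toSphere := by
  have h1 : ∫⁻ y, F y ∂μ = ∫⁻ y : ({0}ᶜ : Set E), F y ∂(μ.comap (↑)) := by
    rw [lintegral_subtype_comap (measurableSet_singleton _).compl,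
      restrict_compl_singleton]
  have h2 := (μ.measurePreserving_homeomorphUnitSphereProd).lintegral_comp_emb
    (Homeomorph.measurableEmbedding _) (fun p => F ((p.2 : ℝ) • (p.1 : E)))
  have h3 : ∀ y : ({0}ᶜ : Set E), ((homeomorphUnitSphereProd E y).2 : ℝ) •
      ((homeomorphUnitSphereProd E y).1 : E) = y := by
    intro y
    have hy : ‖(y : E)‖ ≠ 0 := norm_ne_zero_iff.2 y.2
    simp [smul_smul, hy]
  simp only [h3] at h2
  rw [h1, h2, lintegral_prod]
  · refine lintegral_congr fun x => ?_
    rw [Measure.volumeIoiPow, lintegral_withDensity_eq_lintegral_mul]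
    · simp only [Pi.mul_apply]
      rw [lintegral_subtype_comap measurableSet_Ioi
        (fun r : ℝ => ENNReal.ofReal (r ^ (Module.finrank ℝ E - 1)) * F (r • (x : E)))]
    · fun_prop
    · fun_prop
  · fun_prop

lemma lintegral_norm_eq {E : Type*} [NormedAddCommGroup E] [NormedSpace ℝ E]
    [FiniteDimensional ℝ E] [MeasurableSpace E] [BorelSpace E] [Nontrivial E] (μ : Measure E)
    [μ.IsAddHaarMeasure] {f : ℝ → ℝ≥0∞} (hf : Measurable f) :
    ∫⁻ y, f ‖y‖ ∂μ = μ.toSphere Set.univ * ∫⁻ r in Set.Ioi (0 : ℝ),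
      ENNReal.ofReal (r ^ (Module.finrank ℝ E - 1)) * f r := by
  rw [lintegral_eq_lintegral_toSphere μ (by fun_prop), mul_comm, ← lintegral_const]
  refine lintegral_congr fun x => setLIntegral_congr_fun measurableSet_Ioi fun r hr => ?_
  have : ‖(x : E)‖ = 1 := by simp
  simp only [norm_smul, this, mul_one, Real.norm_eq_abs, abs_of_pos (Set.mem_Ioi.1 hr)]

/-- The radial integral `∫_0^1 r^d dr` used to pass from the ball to the sphere. -/
lemma lintegral_radial_pos_lt_top (d : ℕ) :
    (∫⁻ r in Set.Ioi (0 : ℝ), ENNReal.ofReal (r ^ d) * (Set.Iio (1 : ℝ)).indicator 1 r) ≠ 0 ∧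
    (∫⁻ r in Set.Ioi (0 : ℝ), ENNReal.ofReal (r ^ d) * (Set.Iio (1 : ℝ)).indicator 1 r) ≠ ∞ := by
  have hm : Measurable fun r : ℝ =>
      ENNReal.ofReal (r ^ d) * (Set.Iio (1 : ℝ)).indicator (1 : ℝ → ℝ≥0∞) r :=
    (by fun_prop : Measurable fun r : ℝ => ENNReal.ofReal (r ^ d)).mul
      (measurable_one.indicator measurableSet_Iio)
  constructor
  · rw [← pos_iff_ne_zero, setLIntegral_pos_iff hm]
    refine lt_of_lt_of_le ?_ (measure_mono (s := Set.Ioo (0 : ℝ) 1) fun r hr => ?_)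
    · simp
    · refine ⟨?_, hr.1⟩
      have : 0 < r ^ d := pow_pos hr.1 d
      simp [hr.2, this]
  · refine ne_of_lt (lt_of_le_of_lt (setLIntegral_mono'
      (g := (Set.Iio (1 : ℝ)).indicator 1) measurableSet_Ioi fun r hr => ?_) ?_)
    · by_cases h1 : r < 1
      · simpa [h1] using pow_le_one₀ (Set.mem_Ioi.1 hr).le h1.le
      · simp [h1]
    · rw [lintegral_indicator_one measurableSet_Iio, Measure.restrict_apply measurableSet_Iio,
        Set.inter_comm, Set.Ioi_inter_Iio]
      simp

/-- The surface measure is invariant under linear isometries. -/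
lemma lintegral_surface_comp_isometry {k : ℕ} (hk : 0 < k)
    (L : EuclideanSpace ℝ (Fin k) ≃ₗᵢ[ℝ] EuclideanSpace ℝ (Fin k))
    {f : EuclideanSpace ℝ (Fin k) → ℝ≥0∞} (hf : Measurable f) :
    ∫⁻ x, f (L x) ∂(surface k) = ∫⁻ x, f x ∂(surface k) := by
  have : NeZero k := ⟨hk.ne'⟩
  -- Extending `f` to the unit ball as a function of direction alone multiplies its integral by a
  -- positive finite radial constant. Invariance of the sphere measure is thus inherited from
  -- Lebesgue measure.
  have key : ∀ {f : EuclideanSpace ℝ (Fin k) → ℝ≥0∞}, Measurable f →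
      ∫⁻ y : EuclideanSpace ℝ (Fin k), (Set.Iio (1:ℝ)).indicator 1 ‖y‖ * f (‖y‖⁻¹ • y) =
      (∫⁻ x, f x ∂(surface k)) * ∫⁻ r in Set.Ioi (0 : ℝ),
        ENNReal.ofReal (r ^ (k - 1)) * (Set.Iio (1 : ℝ)).indicator 1 r := by
    intro f hf
    have hi : Measurable ((Set.Iio (1:ℝ)).indicator (1 : ℝ → ℝ≥0∞)) :=
      measurable_one.indicator measurableSet_Iio
    rw [lintegral_eq_lintegral_toSphere _ (by fun_prop), surface, ← lintegral_mul_const]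
    · refine lintegral_congr fun x => ?_
      rw [mul_comm, ← lintegral_mul_const]
      · refine setLIntegral_congr_fun measurableSet_Ioi fun r hr => ?_
        have hx : ‖(x : EuclideanSpace ℝ (Fin k))‖ = 1 := by simp
        have hr' : (0:ℝ) < r := hr
        simp only [norm_smul, hx, mul_one, Real.norm_eq_abs, abs_of_pos hr', smul_smul,
          inv_mul_cancel₀ hr'.ne', one_smul, finrank_euclideanSpace, Fintype.card_fin]
        ring
      · fun_prop
    · fun_prop
  have hL : Measurable fun y => f (L y) := hf.comp L.continuous.measurable
  have h1 := key hL
  have h2 := key hf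
  rw [← (L.measurePreserving).lintegral_comp_emb L.toMeasurableEquiv.measurableEmbedding] at h2
  simp only [L.norm_map] at h2
  simp only [map_smul] at h1
  rw [h2] at h1
  exact ((ENNReal.mul_left_inj (lintegral_radial_pos_lt_top _).1
    (lintegral_radial_pos_lt_top _).2).1 h1).symm

/-- An arbitrary isometric identification sends the first axis to some unit vector; the reflection
exchanging that vector with `θ` corrects it. This reduces the coordinate along `θ` to the first
coordinate of a product. -/
lemma exists_isometry_of_sphere {m : ℕ} (θ : Sph (m + 1)) :
    ∃ e : WithLp 2 (ℝ × EuclideanSpace ℝ (Fin m)) ≃ₗᵢ[ℝ] EuclideanSpace ℝ (Fin (m + 1)),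
      e (WithLp.toLp 2 (1, 0)) = θ := by
  let E' := WithLp 2 (ℝ × EuclideanSpace ℝ (Fin m))
  have hd : Module.finrank ℝ E' = m + 1 := by
    have : Module.finrank ℝ E' = Module.finrank ℝ (ℝ × EuclideanSpace ℝ (Fin m)) :=
      (WithLp.linearEquiv 2 ℝ (ℝ × EuclideanSpace ℝ (Fin m))).finrank_eq
    rw [this, Module.finrank_prod]
    simp [add_comm]
  let e₀ := ((stdOrthonormalBasis ℝ E').reindex (finCongr hd)).repr
  have hn : ‖e₀ (WithLp.toLp 2 (1, 0))‖ = ‖(θ : EuclideanSpace ℝ (Fin (m + 1)))‖ := by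
    rw [e₀.norm_map, WithLp.prod_norm_eq_of_L2]
    simp
  refine ⟨e₀.trans (Submodule.reflection
    (ℝ ∙ (e₀ (WithLp.toLp 2 (1, 0)) - (θ : EuclideanSpace ℝ (Fin (m + 1)))))ᗮ), ?_⟩
  rw [LinearIsometryEquiv.trans_apply]
  exact Submodule.reflection_sub hn

/-- Integration over `ℝ^{m+1}` of a function of the norm and of the coordinate along `θ`. -/
lemma lintegral_norm_inner {m : ℕ} (hm : 0 < m) (θ : Sph (m + 1)) {F : ℝ → ℝ → ℝ≥0∞}
    (hF : Measurable fun p : ℝ × ℝ => F p.1 p.2) :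
    ∫⁻ y : EuclideanSpace ℝ (Fin (m + 1)),
      F ‖y‖ ⟪y, (θ : EuclideanSpace ℝ (Fin (m + 1)))⟫_ℝ =
    (volume : Measure (EuclideanSpace ℝ (Fin m))).toSphere Set.univ *
      ∫⁻ u : ℝ, ∫⁻ r in Set.Ioi (0 : ℝ),
        ENNReal.ofReal (r ^ (m - 1)) * F (√(u ^ 2 + r ^ 2)) u := by
  have : NeZero m := ⟨hm.ne'⟩
  obtain ⟨e, he⟩ := exists_isometry_of_sphere θ
  rw [← e.measurePreserving.lintegral_comp_emb e.toMeasurableEquiv.measurableEmbedding,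
    ← (WithLp.volume_preserving_toLp ℝ (EuclideanSpace ℝ (Fin m))).lintegral_comp_emb
      (MeasurableEquiv.toLp 2 (ℝ × EuclideanSpace ℝ (Fin m))).measurableEmbedding]
  simp only [e.norm_map, ← he, LinearIsometryEquiv.inner_map_map]
  have h1 : ∀ p : ℝ × EuclideanSpace ℝ (Fin m),
      ⟪WithLp.toLp 2 p, WithLp.toLp 2 ((1 : ℝ), (0 : EuclideanSpace ℝ (Fin m)))⟫_ℝ = p.1 := by
    intro p
    simp [WithLp.prod_inner_apply]
  have h2 : ∀ p : ℝ × EuclideanSpace ℝ (Fin m), ‖WithLp.toLp 2 p‖ = √(p.1 ^ 2 + ‖p.2‖ ^ 2) := by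
    intro p
    rw [WithLp.prod_norm_eq_of_L2]
    simp
  simp only [h1, h2]
  have hF' : ∀ {α : Type} [MeasurableSpace α] {f g : α → ℝ}, Measurable f → Measurable g →
      Measurable fun a => F (f a) (g a) := fun hf hg => hF.comp (hf.prodMk hg)
  rw [Measure.volume_eq_prod, lintegral_prod]
  · rw [← lintegral_const_mul]
    · refine lintegral_congr fun u => ?_
      rw [lintegral_norm_eq (volume : Measure (EuclideanSpace ℝ (Fin m)))
        (f := fun r => F (√(u ^ 2 + r ^ 2)) u) (hF' (by fun_prop) (by fun_prop))]
      simp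
    · refine Measurable.lintegral_prod_right' (f := fun p : ℝ × ℝ =>
        ENNReal.ofReal (p.2 ^ (m - 1)) * F (√(p.1 ^ 2 + p.2 ^ 2)) p.1) ?_
      exact (by fun_prop : Measurable fun p : ℝ × ℝ => ENNReal.ofReal (p.2 ^ (m - 1))).mul
        (hF' (by fun_prop) (by fun_prop))
  · exact (hF' (by fun_prop) (by fun_prop)).aemeasurable

/-- The density `(1 - t²)^{(k-3)/2}` of the projection of the uniform distribution. -/
noncomputable def weight (k : ℕ) (t : ℝ) : ℝ := (1 - t ^ 2) ^ (((k : ℝ) - 3) / 2)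

lemma measurable_weight (k : ℕ) : Measurable (weight k) := by
  unfold weight; fun_prop

/-- Substitution `t = cos φ`: the weight becomes `sin^{m-2} φ` and the Jacobian supplies one more
factor `sin φ`. -/
lemma lintegral_sin_pow {m : ℕ} (hm : 0 < m) {f : ℝ → ℝ≥0∞} :
    ∫⁻ t in Set.Ioo (-1 : ℝ) 1, ENNReal.ofReal (weight (m + 1) t) * f t =
      ∫⁻ φ in Set.Ioo 0 Real.pi, ENNReal.ofReal (Real.sin φ ^ (m - 1)) * f (Real.cos φ) := by
  have him : Real.cos '' Set.Ioo 0 Real.pi = Set.Ioo (-1) 1 := by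
    refine Set.Subset.antisymm Real.mapsTo_cos_Ioo.image_subset fun t ht => ?_
    refine ⟨Real.arccos t, ⟨Real.arccos_pos.2 ht.2, ?_⟩, Real.cos_arccos ht.1.le ht.2.le⟩
    refine lt_of_le_of_ne (Real.arccos_le_pi t) fun h => ?_
    have := Real.arccos_eq_pi.1 h
    linarith [ht.1]
  rw [← him, lintegral_image_eq_lintegral_abs_deriv_mul measurableSet_Ioo
    (fun x _ => (Real.hasDerivAt_cos x).hasDerivWithinAt)
    (Real.injOn_cos.mono Set.Ioo_subset_Icc_self)]
  refine setLIntegral_congr_fun measurableSet_Ioo fun φ hφ => ?_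
  have hs : 0 < Real.sin φ := Real.sin_pos_of_mem_Ioo hφ
  rw [abs_neg, abs_of_pos hs, ← mul_assoc, ← ENNReal.ofReal_mul hs.le]
  congr 2
  have : 1 - Real.cos φ ^ 2 = Real.sin φ ^ (2 : ℝ) := by
    rw [Real.rpow_two, ← Real.sin_sq_add_cos_sq φ]; ring
  have hadd (y : ℝ) : Real.sin φ * Real.sin φ ^ y = Real.sin φ ^ (1 + y) := by
    rw [Real.rpow_add hs, Real.rpow_one]
  rw [weight, this, ← Real.rpow_mul hs.le, hadd, ← Real.rpow_natCast]
  congr 1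
  rw [Nat.cast_sub hm]
  push_cast
  ring

/-- The half-plane integral in polar coordinates. -/
lemma lintegral_halfplane {m : ℕ} (hm : 0 < m) {g f : ℝ → ℝ≥0∞} (hg : Measurable g)
    (hf : Measurable f) :
    ∫⁻ u : ℝ, ∫⁻ r in Set.Ioi (0 : ℝ), ENNReal.ofReal (r ^ (m - 1)) *
        (g (√(u ^ 2 + r ^ 2)) * f (u / √(u ^ 2 + r ^ 2))) =
      (∫⁻ r in Set.Ioi (0 : ℝ), ENNReal.ofReal (r ^ m) * g r) *
        ∫⁻ φ in Set.Ioo 0 Real.pi, ENNReal.ofReal (Real.sin φ ^ (m - 1)) * f (Real.cos φ) := by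
  -- The indicator extends the integrand by zero to the whole plane, where planar polar coordinates
  -- apply; it then restricts the angle to `(0, π)`.
  let G : ℝ × ℝ → ℝ≥0∞ := fun p => (Set.Ioi (0 : ℝ)).indicator 1 p.2 *
    (ENNReal.ofReal (p.2 ^ (m - 1)) * (g (√(p.1 ^ 2 + p.2 ^ 2)) * f (p.1 / √(p.1 ^ 2 + p.2 ^ 2))))
  have hi : Measurable ((Set.Ioi (0 : ℝ)).indicator (1 : ℝ → ℝ≥0∞)) :=
    measurable_one.indicator measurableSet_Ioi
  have hG : Measurable G := by fun_prop
  have h1 : ∫⁻ u : ℝ, ∫⁻ r in Set.Ioi (0 : ℝ), ENNReal.ofReal (r ^ (m - 1)) *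
        (g (√(u ^ 2 + r ^ 2)) * f (u / √(u ^ 2 + r ^ 2))) = ∫⁻ p, G p := by
    rw [Measure.volume_eq_prod, lintegral_prod _ hG.aemeasurable]
    refine lintegral_congr fun u => ?_
    rw [← lintegral_indicator measurableSet_Ioi]
    refine lintegral_congr fun r => ?_
    by_cases hr : 0 < r <;> simp [G, hr]
  rw [h1, ← lintegral_comp_polarCoord_symm, polarCoord_target, Measure.volume_eq_prod,
    ← Measure.prod_restrict, lintegral_prod]
  · rw [← lintegral_mul_const]
    · refine setLIntegral_congr_fun measurableSet_Ioi fun r hr => ?_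
      have hr' : (0 : ℝ) < r := hr
      have hint : ∀ φ ∈ Set.Ioo (-Real.pi) Real.pi,
          ENNReal.ofReal r • G (polarCoord.symm (r, φ)) =
          (Set.Ioo 0 Real.pi).indicator (fun φ => (ENNReal.ofReal (r ^ m) * g r) *
            (ENNReal.ofReal (Real.sin φ ^ (m - 1)) * f (Real.cos φ))) φ := by
        intro φ hφ
        have hsq : √((r * Real.cos φ) ^ 2 + (r * Real.sin φ) ^ 2) = r := by
          rw [show (r * Real.cos φ) ^ 2 + (r * Real.sin φ) ^ 2 = r ^ 2 by
            rw [mul_pow, mul_pow, ← mul_add, Real.cos_sq_add_sin_sq, mul_one],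
            Real.sqrt_sq hr'.le]
        have hdiv : r * Real.cos φ / r = Real.cos φ := by field_simp
        simp only [polarCoord_symm_apply, G, hsq, hdiv, smul_eq_mul]
        by_cases h0 : 0 < φ
        · have hs : 0 < Real.sin φ := Real.sin_pos_of_pos_of_lt_pi h0 hφ.2
          have hrs : 0 < r * Real.sin φ := mul_pos hr' hs
          rw [Set.indicator_of_mem (show φ ∈ Set.Ioo 0 Real.pi from ⟨h0, hφ.2⟩),
            Set.indicator_of_mem (show r * Real.sin φ ∈ Set.Ioi (0 : ℝ) from hrs), Pi.one_apply,
            one_mul, mul_pow, ENNReal.ofReal_mul (by positivity),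
            show r ^ m = r * r ^ (m - 1) by rw [← pow_succ', Nat.sub_add_cancel hm],
            ENNReal.ofReal_mul hr'.le]
          ring
        · have hs : Real.sin φ ≤ 0 :=
            Real.sin_nonpos_of_nonpos_of_neg_pi_le (not_lt.1 h0) hφ.1.le
          have hrs : ¬ 0 < r * Real.sin φ := not_lt.2 (mul_nonpos_of_nonneg_of_nonpos hr'.le hs)
          rw [Set.indicator_of_notMem (show φ ∉ Set.Ioo 0 Real.pi from fun h => h0 h.1),
            Set.indicator_of_notMem (show r * Real.sin φ ∉ Set.Ioi (0 : ℝ) from hrs)]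
          simp
      simp only
      rw [setLIntegral_congr_fun measurableSet_Ioo hint, lintegral_indicator measurableSet_Ioo,
        Measure.restrict_restrict measurableSet_Ioo, Set.Ioo_inter_Ioo, lintegral_const_mul]
      · rw [max_eq_left (by linarith [Real.pi_pos]), min_self]
      · fun_prop
    · fun_prop
  · have : Measurable polarCoord.symm := by
      show Measurable fun p : ℝ × ℝ => (p.1 * Real.cos p.2, p.1 * Real.sin p.2)
      fun_prop
    fun_prop

/-- The law of `x'θ` under the surface measure has density proportional to
`(1 - t²)^{(k-3)/2}` on `[-1, 1]`. -/
lemma lintegral_surface_inner {k : ℕ} (hk : 2 ≤ k) :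
    ∃ C : ℝ≥0∞, C ≠ 0 ∧ C ≠ ∞ ∧ ∀ θ : Sph k, ∀ f : ℝ → ℝ≥0∞, Measurable f →
    ∫⁻ x, f ⟪(x : EuclideanSpace ℝ (Fin k)), (θ : EuclideanSpace ℝ (Fin k))⟫_ℝ ∂(surface k) =
      C * ∫⁻ t in Set.Ioo (-1 : ℝ) 1, ENNReal.ofReal (weight k t) * f t := by
  obtain ⟨m, rfl⟩ : ∃ m, k = m + 1 := ⟨k - 1, by omega⟩
  have hm : 0 < m := by omega
  have : NeZero m := ⟨hm.ne'⟩
  refine ⟨(volume : Measure (EuclideanSpace ℝ (Fin m))).toSphere Set.univ, ?_, ?_, ?_⟩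
  · rw [Ne, Measure.measure_univ_eq_zero]
    exact Measure.toSphere_ne_zero _
  · exact measure_ne_top _ _
  intro θ f hf
  -- The cutoff only makes the radial factor finite; the integral over the unit ball is computed in
  -- two ways and this common factor cancels at the end.
  let g : ℝ → ℝ≥0∞ := (Set.Iio (1:ℝ)).indicator 1
  have hg : Measurable g := measurable_one.indicator measurableSet_Iio
  have h1 := lintegral_norm_inner hm θ (F := fun a u => g a * f (u / a)) (by fun_prop)
  rw [lintegral_halfplane hm hg hf, ← lintegral_sin_pow hm,
    lintegral_eq_lintegral_toSphere _ (by fun_prop)] at h1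
  have h2 : ∀ x : Sph (m + 1), ∫⁻ r in Set.Ioi (0 : ℝ),
      ENNReal.ofReal (r ^ (Module.finrank ℝ (EuclideanSpace ℝ (Fin (m + 1))) - 1)) *
        (g ‖r • (x : EuclideanSpace ℝ (Fin (m + 1)))‖ *
          f (⟪r • (x : EuclideanSpace ℝ (Fin (m + 1))), (θ : EuclideanSpace ℝ (Fin (m + 1)))⟫_ℝ /
            ‖r • (x : EuclideanSpace ℝ (Fin (m + 1)))‖)) =
      (∫⁻ r in Set.Ioi (0 : ℝ), ENNReal.ofReal (r ^ m) * g r) *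
      f ⟪(x : EuclideanSpace ℝ (Fin (m + 1))), (θ : EuclideanSpace ℝ (Fin (m + 1)))⟫_ℝ := by
    intro x
    rw [← lintegral_mul_const _ (by fun_prop)]
    refine setLIntegral_congr_fun measurableSet_Ioi fun r hr => ?_
    have hx : ‖(x : EuclideanSpace ℝ (Fin (m + 1)))‖ = 1 := by simp
    have hr' : (0:ℝ) < r := hr
    simp only [norm_smul, hx, mul_one, Real.norm_eq_abs, abs_of_pos hr', real_inner_smul_left,
      mul_div_cancel_left₀ _ hr'.ne', finrank_euclideanSpace, Fintype.card_fin,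
      Nat.add_sub_cancel]
    ring
  rw [lintegral_congr h2, lintegral_const_mul _ (by fun_prop), mul_left_comm] at h1
  exact (ENNReal.mul_right_inj (lintegral_radial_pos_lt_top m).1
    (lintegral_radial_pos_lt_top m).2).1 h1

/-! ### Moments of the FvML distribution. -/

/-- The coordinate of a point of the sphere along `θ`. -/
noncomputable def proj {k : ℕ} (θ x : Sph k) : ℝ :=
  ⟪(x : EuclideanSpace ℝ (Fin k)), (θ : EuclideanSpace ℝ (Fin k))⟫_ℝ

lemma continuous_proj {k : ℕ} (θ : Sph k) : Continuous (proj θ) := by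
  unfold proj; fun_prop

@[fun_prop]
lemma measurable_proj {k : ℕ} (θ : Sph k) : Measurable (proj θ) := (continuous_proj θ).measurable

lemma abs_proj_le {k : ℕ} (θ x : Sph k) : |proj θ x| ≤ 1 := by
  have h1 : ‖(θ : EuclideanSpace ℝ (Fin k))‖ = 1 := by simp
  have h2 : ‖(x : EuclideanSpace ℝ (Fin k))‖ = 1 := by simp
  simpa [proj, h1, h2] using
    abs_real_inner_le_norm (x : EuclideanSpace ℝ (Fin k)) (θ : EuclideanSpace ℝ (Fin k))

instance isFiniteMeasure_surface (k : ℕ) : IsFiniteMeasure (surface k) := by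
  unfold surface; infer_instance

lemma integrable_of_continuous {k : ℕ} (μ : Measure (Sph k)) [IsFiniteMeasure μ] {E : Type*}
    [NormedAddCommGroup E] {f : Sph k → E} (hf : Continuous f) : Integrable f μ := by
  rw [← integrableOn_univ]
  exact hf.continuousOn.integrableOn_compact isCompact_univ

lemma weight_nonneg (k : ℕ) {t : ℝ} (ht : t ∈ Set.Ioo (-1 : ℝ) 1) : 0 ≤ weight k t :=
  Real.rpow_nonneg (by nlinarith [ht.1, ht.2]) _

lemma weight_pos (k : ℕ) {t : ℝ} (ht : t ∈ Set.Ioo (-1 : ℝ) 1) : 0 < weight k t :=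
  Real.rpow_pos_of_pos (by nlinarith [ht.1, ht.2]) _

lemma map_proj_surface {k : ℕ} (hk : 2 ≤ k) :
    ∃ C : ℝ≥0∞, C ≠ 0 ∧ C ≠ ∞ ∧ ∀ θ : Sph k, (surface k).map (proj θ) =
      C • (volume.restrict (Set.Ioo (-1 : ℝ) 1)).withDensity
        fun t => ENNReal.ofReal (weight k t) := by
  obtain ⟨C, h0, h1, h⟩ := lintegral_surface_inner hk
  refine ⟨C, h0, h1, fun θ => Measure.ext_of_lintegral _ fun f hf => ?_⟩
  rw [lintegral_map hf (measurable_proj θ), lintegral_smul_measure,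
    lintegral_withDensity_eq_lintegral_mul _ (measurable_weight k).ennreal_ofReal hf]
  exact h θ f hf

lemma integral_surface_proj {k : ℕ} (hk : 2 ≤ k) :
    ∃ C : ℝ, 0 < C ∧ ∀ θ : Sph k, ∀ f : ℝ → ℝ, Measurable f →
      ∫ x, f (proj θ x) ∂(surface k) = C * ∫ t in (-1 : ℝ)..1, f t * weight k t := by
  obtain ⟨C, h0, h1, h⟩ := map_proj_surface hk
  refine ⟨C.toReal, ENNReal.toReal_pos h0 h1, fun θ f hf => ?_⟩
  rw [← integral_map (measurable_proj θ).aemeasurable hf.aestronglyMeasurable, h θ,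
    integral_smul_measure, intervalIntegral.integral_of_le (by norm_num),
    integral_Ioc_eq_integral_Ioo, smul_eq_mul,
    integral_withDensity_eq_integral_toReal_smul (measurable_weight k).ennreal_ofReal
      (by simp)]
  congr 1
  refine setIntegral_congr_fun measurableSet_Ioo fun t ht => ?_
  simp [ENNReal.toReal_ofReal (weight_nonneg k ht), mul_comm]

lemma nonempty_sphere {k : ℕ} (hk : 2 ≤ k) : Nonempty (Sph k) :=
  ⟨⟨EuclideanSpace.single ⟨0, by omega⟩ 1, by simp⟩⟩

/-- For `k = 2` the weight is unbounded at `±1`, so continuity is not enough. Integrability is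
pulled from the finiteness of the surface measure instead. -/
lemma intervalIntegrable_mul_weight {k : ℕ} (hk : 2 ≤ k) {f : ℝ → ℝ} (hf : Continuous f) :
    IntervalIntegrable (fun t => f t * weight k t) volume (-1) 1 := by
  obtain ⟨C, h0, h1, h⟩ := map_proj_surface hk
  obtain ⟨θ⟩ := nonempty_sphere hk
  have hi : Integrable f ((surface k).map (proj θ)) := by
    rw [integrable_map_measure hf.aestronglyMeasurable (measurable_proj θ).aemeasurable]
    exact integrable_of_continuous _ (hf.comp (continuous_proj θ))
  rw [h θ, integrable_smul_measure h0 h1, integrable_withDensity_iff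
    (measurable_weight k).ennreal_ofReal (by simp)] at hi
  rw [intervalIntegrable_iff_integrableOn_Ioo_of_le (by norm_num)]
  refine Integrable.congr hi ?_
  filter_upwards [ae_restrict_mem measurableSet_Ioo] with t ht
  simp [ENNReal.toReal_ofReal (weight_nonneg k ht)]

lemma integral_exp_weight_pos {k : ℕ} (hk : 2 ≤ k) (κ : ℝ) :
    0 < ∫ t in (-1 : ℝ)..1, Real.exp (κ * t) * weight k t :=
  intervalIntegral.intervalIntegral_pos_of_pos_on
    (intervalIntegrable_mul_weight hk (f := fun t => Real.exp (κ * t)) (by fun_prop))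
    (fun _ ht => mul_pos (Real.exp_pos _) (weight_pos k ht)) (by norm_num)

/-- Expectations of functions of `x'θ` under the FvML distribution. -/
lemma integral_fvml_proj {k : ℕ} (hk : 2 ≤ k) (κ : ℝ) (θ : Sph k) {f : ℝ → ℝ}
    (hf : Measurable f) :
    ∫ x, f (proj θ x) ∂(fvml κ θ) =
      (∫ t in (-1 : ℝ)..1, f t * Real.exp (κ * t) * weight k t) /
        ∫ t in (-1 : ℝ)..1, Real.exp (κ * t) * weight k t := by
  obtain ⟨C, hC, h⟩ := integral_surface_proj hk
  have h1 := h θ (fun t => Real.exp (κ * t)) (by fun_prop)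
  have h2 := h θ (fun t => f t * Real.exp (κ * t)) (by fun_prop)
  have h3 : ∫ x, f (proj θ x) ∂(fvml κ θ) =
      (∫ x, f (proj θ x) * Real.exp (κ * proj θ x) ∂(surface k)) /
        ∫ x, Real.exp (κ * proj θ x) ∂(surface k) := by
    rw [fvml, integral_tilted, ← integral_div]
    refine integral_congr_ae (Eventually.of_forall fun x => ?_)
    simp only [smul_eq_mul, proj]
    ring
  rw [h3, h1, h2, mul_div_mul_left _ _ hC.ne']

lemma integral_proj {k : ℕ} (hk : 2 ≤ k) (κ : ℝ) (θ : Sph k) :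
    ∫ x, proj θ x ∂(fvml κ θ) = A k κ :=
  integral_fvml_proj hk κ θ (f := fun t => t) measurable_id

/-- Integration by parts for the second moment. -/
lemma integral_one_sub_sq {k : ℕ} (hk : 2 ≤ k) (κ : ℝ) :
    κ * ∫ t in (-1 : ℝ)..1, (1 - t ^ 2) * Real.exp (κ * t) * weight k t =
      ((k : ℝ) - 1) * ∫ t in (-1 : ℝ)..1, t * Real.exp (κ * t) * weight k t := by
  have hk' : (2 : ℝ) ≤ k := by exact_mod_cast hk
  have hp : (0 : ℝ) < ((k : ℝ) - 1) / 2 := by linarith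
  have hi1 := intervalIntegrable_mul_weight hk
    (f := fun t => (1 - t ^ 2) * Real.exp (κ * t)) (by fun_prop)
  have hi2 := intervalIntegrable_mul_weight hk (f := fun t => t * Real.exp (κ * t)) (by fun_prop)
  -- The antiderivative `e^{κt}(1 - t²)^{(k-1)/2}` is continuous and vanishes at both endpoints
  -- since its exponent is positive; differentiability is only needed in the open interval.
  have key := intervalIntegral.integral_eq_sub_of_hasDerivAt_of_le (a := -1) (b := 1)
    (f := fun t => Real.exp (κ * t) * (1 - t ^ 2) ^ (((k : ℝ) - 1) / 2))
    (f' := fun t => κ * ((1 - t ^ 2) * Real.exp (κ * t) * weight k t) -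
      ((k : ℝ) - 1) * (t * Real.exp (κ * t) * weight k t)) (by norm_num) ?_ ?_
      ((hi1.const_mul κ).sub (hi2.const_mul _))
  · rw [intervalIntegral.integral_sub (hi1.const_mul κ) (hi2.const_mul _),
      intervalIntegral.integral_const_mul, intervalIntegral.integral_const_mul] at key
    simp only [one_pow, sub_self, even_two, Even.neg_pow, Real.zero_rpow hp.ne', mul_zero] at key
    linarith
  · refine Continuous.continuousOn ?_
    have : Continuous fun t : ℝ => (1 - t ^ 2) ^ (((k : ℝ) - 1) / 2) :=
      (by fun_prop : Continuous fun t : ℝ => 1 - t ^ 2).rpow_const fun _ => Or.inr hp.le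
    fun_prop
  · intro t ht
    have hpos : 0 < 1 - t ^ 2 := by nlinarith [ht.1, ht.2]
    have d1 : HasDerivAt (fun t => Real.exp (κ * t)) (Real.exp (κ * t) * κ) t := by
      simpa using ((hasDerivAt_id t).const_mul κ).exp
    have d2 : HasDerivAt (fun t : ℝ => 1 - t ^ 2) (-(2 * t)) t := by
      simpa using ((hasDerivAt_id t).pow 2).const_sub 1
    have d3 := d2.rpow_const (p := ((k : ℝ) - 1) / 2) (Or.inl hpos.ne')
    convert! d1.mul d3 using 1
    have e1 : ((k : ℝ) - 1) / 2 - 1 = ((k : ℝ) - 3) / 2 := by ring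
    have e2 : (1 - t ^ 2) ^ (((k : ℝ) - 1) / 2) = (1 - t ^ 2) * weight k t := by
      rw [weight, ← Real.rpow_one_add' hpos.le (by linarith)]
      congr 1; ring
    rw [e1, e2, weight]
    ring

/-- The integration by parts says that `1 - (x'θ)²` has expectation `(k-1) A_k(κ)/κ`; this
identifies `info` as a variance. -/
lemma integral_proj_sub_sq {k : ℕ} (hk : 2 ≤ k) {κ : ℝ} (hκ : κ ≠ 0) (θ : Sph k) :
    ∫ x, (proj θ x - A k κ) ^ 2 ∂(fvml κ θ) = info k κ := by
  have hZ := (integral_exp_weight_pos hk κ).ne'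
  have hc := continuous_proj θ
  have h1 : ∫ x, (1 - proj θ x ^ 2) ∂(fvml κ θ) = ((k : ℝ) - 1) / κ * A k κ := by
    rw [integral_fvml_proj hk κ θ (f := fun t => 1 - t ^ 2) (by fun_prop),
      ← integral_proj hk κ θ, integral_fvml_proj hk κ θ (f := fun t => t) (by fun_prop)]
    have := integral_one_sub_sq hk κ
    rw [div_mul_div_comm, div_eq_div_iff hZ (mul_ne_zero hκ hZ)]
    linear_combination (∫ t in (-1 : ℝ)..1, Real.exp (κ * t) * weight k t) * this
  have h2 : ∀ x, (proj θ x - A k κ) ^ 2 =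
      (1 + A k κ ^ 2) - (1 - proj θ x ^ 2) - 2 * A k κ * proj θ x := fun x => by ring
  simp only [h2]
  rw [integral_sub (integrable_of_continuous _ (by fun_prop))
    (integrable_of_continuous _ (by fun_prop)), integral_sub (integrable_of_continuous _
    (by fun_prop)) (integrable_of_continuous _ (by fun_prop)), h1, integral_const_mul,
    integral_proj hk]
  simp [info]
  ring

/-- A variance under a density positive on `(-1, 1)` cannot vanish. -/
lemma info_pos {k : ℕ} (hk : 2 ≤ k) {κ : ℝ} (hκ : κ ≠ 0) : 0 < info k κ := by
  obtain ⟨θ⟩ := nonempty_sphere hk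
  rw [← integral_proj_sub_sq hk hκ θ,
    integral_fvml_proj hk κ θ (f := fun t => (t - A k κ) ^ 2) (by fun_prop)]
  refine div_pos ?_ (integral_exp_weight_pos hk κ)
  refine (intervalIntegral.integral_pos_iff_support_of_nonneg_ae' ?_
    (intervalIntegrable_mul_weight hk
      (f := fun t => (t - A k κ) ^ 2 * Real.exp (κ * t)) (by fun_prop))).2 ⟨by norm_num, ?_⟩
  · rw [Set.uIoc_of_le (by norm_num), ← restrict_Ioo_eq_restrict_Ioc]
    filter_upwards [ae_restrict_mem measurableSet_Ioo] with t ht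
    exact mul_nonneg (by positivity) (weight_nonneg k ht)
  · refine lt_of_lt_of_le (b := volume (Set.Ioo (-1 : ℝ) 1 \ {A k κ})) ?_
      (measure_mono fun t ht => ?_)
    · rw [measure_sdiff_null (by simp)]
      simp
    · refine ⟨?_, Set.Ioo_subset_Ioc_self ht.1⟩
      have h1 : t - A k κ ≠ 0 := sub_ne_zero.2 ht.2
      have h2 := weight_pos k ht.1
      exact (by positivity : (t - A k κ) ^ 2 * Real.exp (κ * t) * weight k t ≠ 0)

lemma abs_A_le {k : ℕ} (hk : 2 ≤ k) (κ : ℝ) : |A k κ| ≤ 1 := by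
  obtain ⟨θ⟩ := nonempty_sphere hk
  rw [← integral_proj hk κ θ]
  have := norm_integral_le_of_norm_le_const (μ := fvml κ θ) (f := proj θ) (C := 1)
    (Eventually.of_forall fun x => by simpa using abs_proj_le θ x)
  simpa using this

/-- The mean direction: the expectation of an FvML observation is `A_k(κ) θ`. -/
lemma integral_inner_fvml {k : ℕ} (hk : 2 ≤ k) (κ : ℝ) (θ : Sph k)
    (w : EuclideanSpace ℝ (Fin k)) :
    ∫ x, ⟪(x : EuclideanSpace ℝ (Fin k)), w⟫_ℝ ∂(fvml κ θ) =
      A k κ * ⟪(θ : EuclideanSpace ℝ (Fin k)), w⟫_ℝ := by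
  have hθ : ‖(θ : EuclideanSpace ℝ (Fin k))‖ = 1 := by simp
  set a := ⟪(θ : EuclideanSpace ℝ (Fin k)), w⟫_ℝ with ha
  set v := w - a • (θ : EuclideanSpace ℝ (Fin k)) with hv
  have hvθ : ⟪v, (θ : EuclideanSpace ℝ (Fin k))⟫_ℝ = 0 := by
    rw [hv, inner_sub_left, real_inner_smul_left, real_inner_self_eq_norm_sq, hθ,
      real_inner_comm, ← ha]
    ring
  have h0 : ∫ x, ⟪(x : EuclideanSpace ℝ (Fin k)), v⟫_ℝ ∂(fvml κ θ) = 0 := by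
    -- This reflection fixes `θ` and negates `v`, so it preserves the density and makes the
    -- integrand odd.
    let L := Submodule.reflection (ℝ ∙ v)ᗮ
    let σ := (surface k).map ((↑) : Sph k → EuclideanSpace ℝ (Fin k))
    have hσ : σ.map L = σ := by
      refine Measure.ext_of_lintegral _ fun f hf => ?_
      have hL : Measurable L := L.continuous.measurable
      rw [lintegral_map hf hL, lintegral_map (f := fun x => f (L x)) (hf.comp hL)
        measurable_subtype_coe,
        lintegral_map hf measurable_subtype_coe]
      exact lintegral_surface_comp_isometry (by omega) L hf
    let f : EuclideanSpace ℝ (Fin k) → ℝ := fun x =>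
      Real.exp (κ * ⟪x, (θ : EuclideanSpace ℝ (Fin k))⟫_ℝ) * ⟪x, v⟫_ℝ
    have hLθ : L θ = θ := by
      refine Submodule.reflection_mem_subspace_eq_self ?_
      rwa [Submodule.mem_orthogonal_singleton_iff_inner_right]
    have hLv : L v = -v := Submodule.reflection_orthogonalComplement_singleton_eq_neg v
    have hf : ∀ x, f (L x) = - f x := by
      intro x
      have e1 : ⟪L x, (θ : EuclideanSpace ℝ (Fin k))⟫_ℝ = ⟪x, (θ : EuclideanSpace ℝ (Fin k))⟫_ℝ := by
        conv_lhs => rw [← hLθ]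
        exact L.inner_map_map _ _
      have e2 : ⟪L x, v⟫_ℝ = -⟪x, v⟫_ℝ := by
        rw [← neg_neg v, ← hLv, inner_neg_right, L.inner_map_map, hLv, neg_neg]
      simp only [f, e1, e2]
      ring
    have hfc : Continuous f := by fun_prop
    have e3 : ∫ x, f x ∂σ = - ∫ x, f x ∂σ := by
      conv_lhs => rw [← hσ]
      rw [integral_map L.continuous.measurable.aemeasurable hfc.aestronglyMeasurable,
        ← integral_neg]
      simp only [hf]
    have e4 : ∫ x, f x ∂σ = 0 := by linarith
    rw [integral_map measurable_subtype_coe.aemeasurable hfc.aestronglyMeasurable] at e4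
    rw [fvml, integral_tilted]
    have : ∀ x : Sph k, (Real.exp (κ * ⟪(x : EuclideanSpace ℝ (Fin k)),
        (θ : EuclideanSpace ℝ (Fin k))⟫_ℝ) / ∫ x : Sph k, Real.exp (κ *
        ⟪(x : EuclideanSpace ℝ (Fin k)), (θ : EuclideanSpace ℝ (Fin k))⟫_ℝ) ∂(surface k)) •
        ⟪(x : EuclideanSpace ℝ (Fin k)), v⟫_ℝ = f x / ∫ x : Sph k, Real.exp (κ *
        ⟪(x : EuclideanSpace ℝ (Fin k)), (θ : EuclideanSpace ℝ (Fin k))⟫_ℝ) ∂(surface k) := by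
      intro x
      simp only [f, smul_eq_mul]
      ring
    simp only [this]
    rw [integral_div, e4, zero_div]
  have hw : ∀ x : Sph k, ⟪(x : EuclideanSpace ℝ (Fin k)), w⟫_ℝ =
      ⟪(x : EuclideanSpace ℝ (Fin k)), v⟫_ℝ + a * proj θ x := by
    intro x
    rw [hv, inner_sub_right, real_inner_smul_right, proj]
    ring
  simp only [hw]
  have hc := continuous_proj θ
  rw [integral_add (integrable_of_continuous _ (by fun_prop))
    (integrable_of_continuous _ (by fun_prop)), h0, integral_const_mul, integral_proj hk]
  ring

/-! ### Exponential family structure and likelihood ratios. -/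

lemma pi_tilted {ι α : Type*} [Fintype ι] [MeasurableSpace α] (μ : Measure α)
    [IsProbabilityMeasure μ] {f : α → ℝ} (hf : Integrable (fun x => Real.exp (f x)) μ) :
    Measure.pi (fun _ : ι => μ.tilted f) =
      (Measure.pi fun _ : ι => μ).tilted fun x => ∑ i, f (x i) := by
  have := isProbabilityMeasure_tilted hf
  refine Measure.pi_eq fun s hs => ?_
  simp only [tilted_apply_eq_ofReal_integral' _ (hs _),
    tilted_apply_eq_ofReal_integral' _ (MeasurableSet.univ_pi hs), Real.exp_sum]
  rw [← ENNReal.ofReal_prod_of_nonneg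
    (fun i _ => integral_nonneg fun x => by positivity), integral_fintype_prod_eq_prod
      (𝕜 := ℝ) (fun (_ : ι) (x : α) => Real.exp (f x)), Measure.restrict_pi_pi]
  simp only [div_eq_mul_inv, ← Finset.prod_inv_distrib, ← Finset.prod_mul_distrib]
  rw [integral_fintype_prod_eq_prod (𝕜 := ℝ)
    (fun (i : ι) (x : α) => Real.exp (f x) * (∫ x, Real.exp (f x) ∂μ)⁻¹)]

/-- The score `∑ (x_i'θ - A_k(κ₀))` for the concentration at known location `θ`. -/
noncomputable def score {k : ℕ} (κ₀ : ℝ) (θ : Sph k) (n : ℕ) (x : Fin n → Sph k) : ℝ :=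
  ∑ i, (proj θ (x i) - A k κ₀)

lemma continuous_score {k : ℕ} (κ₀ : ℝ) (θ : Sph k) (n : ℕ) : Continuous (score κ₀ θ n) := by
  have := continuous_proj θ
  unfold score; fun_prop

@[fun_prop]
lemma measurable_score {k : ℕ} (κ₀ : ℝ) (θ : Sph k) (n : ℕ) : Measurable (score κ₀ θ n) := by
  unfold score; fun_prop

/-- The moment generating function of the centered coordinate `x'θ - A_k(κ₀)`. -/
noncomputable def cmgf {k : ℕ} (κ₀ : ℝ) (θ : Sph k) (z : ℂ) : ℂ :=
  ∫ x, Complex.exp (z * ((proj θ x - A k κ₀ : ℝ) : ℂ)) ∂(fvml κ₀ θ)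

lemma integral_exp_score {k : ℕ} (κ₀ : ℝ) (θ : Sph k) (n : ℕ) (z : ℂ) :
    ∫ x, Complex.exp (z * (score κ₀ θ n x : ℂ)) ∂(sampleLaw κ₀ θ n) = cmgf κ₀ θ z ^ n := by
  have := integral_fintype_prod_eq_pow (ι := Fin n) (μ := fvml κ₀ θ)
    (fun x => Complex.exp (z * ((proj θ x - A k κ₀ : ℝ) : ℂ)))
  rw [Fintype.card_fin] at this
  rw [cmgf, ← this, sampleLaw]
  refine integral_congr_ae (Eventually.of_forall fun x => ?_)
  simp only [score]
  rw [← Complex.exp_sum, Complex.ofReal_sum, Finset.mul_sum]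

/-- Tilts compose additively, and subtracting the constant `A_k(κ₀)` in the exponent is absorbed by
the normalization. -/
lemma fvml_eq_tilted {k : ℕ} (κ₀ h : ℝ) (θ : Sph k) :
    fvml (κ₀ + h) θ = (fvml κ₀ θ).tilted fun x => h * (proj θ x - A k κ₀) := by
  have hc := continuous_proj θ
  have h1 : fvml (κ₀ + h) θ = (fvml κ₀ θ).tilted fun x => h * proj θ x := by
    unfold fvml
    rw [tilted_tilted]
    · congr 1
      ext x
      simp only [Pi.add_apply, proj]
      ring
    · exact integrable_of_continuous _ (by fun_prop)
  have h2 := tilted_tilted (μ := fvml κ₀ θ) (f := fun x => h * proj θ x)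
    (integrable_of_continuous _ (by fun_prop)) fun _ => -(h * A k κ₀)
  rw [← h1, tilted_const] at h2
  rw [h2]
  congr 1
  ext x
  simp only [Pi.add_apply]
  ring

lemma sampleLaw_eq_tilted {k : ℕ} (κ₀ h : ℝ) (θ : Sph k) (n : ℕ) :
    sampleLaw (κ₀ + h) θ n = (sampleLaw κ₀ θ n).tilted fun x => h * score κ₀ θ n x := by
  have hc := continuous_proj θ
  unfold sampleLaw
  rw [fvml_eq_tilted, pi_tilted]
  · simp only [score, Finset.mul_sum]
  · exact integrable_of_continuous _ (by fun_prop)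

lemma integrable_sampleLaw_of_continuous {k : ℕ} (κ : ℝ) (θ : Sph k) (n : ℕ) {E : Type*}
    [NormedAddCommGroup E]
    {f : (Fin n → Sph k) → E} (hf : Continuous f) : Integrable f (sampleLaw κ θ n) := by
  rw [← integrableOn_univ]
  exact hf.continuousOn.integrableOn_compact isCompact_univ

/-- The likelihood ratio of `P_{(κ₀ + c/√n, θ)}` with respect to `P_{(κ₀, θ)}`. -/
noncomputable def likelihoodRatio {k : ℕ} (κ₀ c : ℝ) (θ : Sph k) (n : ℕ) (x : Fin n → Sph k) :
    ℝ :=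
  Real.exp (c * (score κ₀ θ n x / √n)) /
    ∫ x, Real.exp (c * (score κ₀ θ n x / √n)) ∂(sampleLaw κ₀ θ n)

lemma integral_sampleLaw_local {k : ℕ} (κ₀ c : ℝ) (θ : Sph k) (n : ℕ) {E : Type*}
    [NormedAddCommGroup E] [NormedSpace ℝ E] (f : (Fin n → Sph k) → E) :
    ∫ x, f x ∂(sampleLaw (κ₀ + c / √n) θ n) =
      ∫ x, likelihoodRatio κ₀ c θ n x • f x ∂(sampleLaw κ₀ θ n) := by
  rw [sampleLaw_eq_tilted, integral_tilted]
  have : ∀ y : ℝ, c / √n * y = c * (y / √n) := fun y => by ring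
  simp only [this, likelihoodRatio]

/-! ### Central limit theorem through moment generating functions, and contiguity. -/

/-- Second order expansion of the moment generating function. -/
lemma norm_cmgf_sub_le {k : ℕ} (hk : 2 ≤ k) {κ₀ : ℝ} (hκ₀ : κ₀ ≠ 0) (θ : Sph k) {z : ℂ}
    (hz : ‖z‖ ≤ 1 / 2) :
    ‖cmgf κ₀ θ z - 1 - z ^ 2 * info k κ₀ / 2‖ ≤ 8 * ‖z‖ ^ 3 := by
  have hc := continuous_proj θ
  have hT : ∀ x, |proj θ x - A k κ₀| ≤ 2 := fun x => by
    have h1 := abs_le.1 (abs_proj_le θ x)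
    have h2 := abs_le.1 (abs_A_le hk κ₀)
    rw [abs_le]; constructor <;> linarith
  have hm1 : ∫ x, ((proj θ x - A k κ₀ : ℝ) : ℂ) ∂(fvml κ₀ θ) = 0 := by
    rw [integral_complex_ofReal, integral_sub (integrable_of_continuous _ hc)
      (integrable_const _), integral_proj hk]
    simp
  have hm2 : ∫ x, ((proj θ x - A k κ₀ : ℝ) : ℂ) ^ 2 ∂(fvml κ₀ θ) = info k κ₀ := by
    rw [← integral_proj_sub_sq hk hκ₀ θ, ← integral_complex_ofReal]
    simp
  have hi : ∀ {f : Sph k → ℂ}, Continuous f → Integrable f (fvml κ₀ θ) :=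
    fun hf => integrable_of_continuous _ hf
  have h1 : cmgf κ₀ θ z - 1 - z ^ 2 * info k κ₀ / 2 =
      ∫ x, (Complex.exp (z * ((proj θ x - A k κ₀ : ℝ) : ℂ)) - 1 -
        z * ((proj θ x - A k κ₀ : ℝ) : ℂ) -
        z ^ 2 / 2 * ((proj θ x - A k κ₀ : ℝ) : ℂ) ^ 2) ∂(fvml κ₀ θ) := by
    rw [integral_sub (hi (by fun_prop)) (hi (by fun_prop)),
      integral_sub (hi (by fun_prop)) (hi (by fun_prop)),
      integral_sub (hi (by fun_prop)) (hi (by fun_prop)), integral_const_mul, integral_const_mul,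
      hm1, hm2, cmgf]
    simp
    ring
  rw [h1]
  refine (norm_integral_le_of_norm_le_const (C := 8 * ‖z‖ ^ 3)
    (Eventually.of_forall fun x => ?_)).trans (by simp)
  set w : ℂ := z * ((proj θ x - A k κ₀ : ℝ) : ℂ) with hw
  have hwn : ‖w‖ ≤ 2 * ‖z‖ := by
    rw [hw, norm_mul, Complex.norm_real, Real.norm_eq_abs, mul_comm]
    exact mul_le_mul_of_nonneg_right (hT x) (norm_nonneg _)
  -- The bound needs `‖w‖ ≤ 1`, which is why `‖z‖ ≤ 1/2` is required. It gives `(2/9)‖w‖³ ≤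
  -- (16/9)‖z‖³`, so the constant 8 is generous.
  have hb := Complex.exp_bound (x := w) (by linarith) (n := 3) (by norm_num)
  have e1 : Complex.exp w - 1 - w - z ^ 2 / 2 * ((proj θ x - A k κ₀ : ℝ) : ℂ) ^ 2 =
      Complex.exp w - ∑ m ∈ Finset.range 3, w ^ m / (m.factorial : ℂ) := by
    simp only [Finset.sum_range_succ, Finset.sum_range_zero, Nat.factorial]
    rw [hw]
    generalize ((proj θ x - A k κ₀ : ℝ) : ℂ) = y
    push_cast
    ring
  rw [e1]
  refine hb.trans ?_
  have h3 : ‖w‖ ^ 3 ≤ (2 * ‖z‖) ^ 3 := pow_le_pow_left₀ (norm_nonneg _) hwn 3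
  have h4 : 0 ≤ ‖z‖ ^ 3 := by positivity
  norm_num [Nat.factorial]
  nlinarith

/-- Write `N log (1 + u) = N u · (log (1 + u)/u)`. The quotient is the slope of the logarithm at 1;
`dslope` makes it continuous there, covering `u j = 0`. -/
lemma tendsto_one_add_pow_exp_comp {N : ℕ → ℕ} (hN : Tendsto N atTop atTop) {u : ℕ → ℂ} {t : ℂ}
    (hu : Tendsto (fun j => (N j : ℂ) * u j) atTop (𝓝 t)) :
    Tendsto (fun j => (1 + u j) ^ N j) atTop (𝓝 (Complex.exp t)) := by
  have hN' : Tendsto (fun j => ((N j : ℂ))⁻¹) atTop (𝓝 0) :=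
    tendsto_inv_atTop_nhds_zero_nat.comp hN
  have hu0 : Tendsto u atTop (𝓝 0) := by
    have := hN'.mul hu
    rw [zero_mul] at this
    refine this.congr' ?_
    filter_upwards [hN.eventually_gt_atTop 0] with j hj
    have : (N j : ℂ) ≠ 0 := by exact_mod_cast hj.ne'
    field_simp
  have hd : ContinuousAt (dslope Complex.log 1) 1 :=
    continuousAt_dslope_same.2 (Complex.hasDerivAt_log (by simp)).differentiableAt
  have h1 : Tendsto (fun j => 1 + u j) atTop (𝓝 1) := by simpa using hu0.const_add 1
  have h2 : Tendsto (fun j => (N j : ℂ) * u j * dslope Complex.log 1 (1 + u j)) atTop (𝓝 t) := by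
    have := hu.mul (hd.tendsto.comp h1)
    rwa [dslope_same, (Complex.hasDerivAt_log (by simp)).deriv, inv_one, mul_one] at this
  refine ((Complex.continuous_exp.tendsto t).comp h2).congr' ?_
  filter_upwards [h1.eventually_ne one_ne_zero] with j hj
  have h3 := sub_smul_dslope Complex.log 1 (1 + u j)
  simp only [add_sub_cancel_left, smul_eq_mul, Complex.log_one, sub_zero] at h3
  rw [Function.comp_apply, mul_assoc, h3, Complex.exp_nat_mul, Complex.exp_log hj]

/-- Moment generating function form of the central limit theorem for the score, uniformly over the
locations. -/
lemma tendsto_cmgf_pow {k : ℕ} (hk : 2 ≤ k) {κ₀ : ℝ} (hκ₀ : κ₀ ≠ 0) {N : ℕ → ℕ}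
    (hN : Tendsto N atTop atTop) (θ : ℕ → Sph k) {z : ℕ → ℂ} {z₀ : ℂ}
    (hz : Tendsto z atTop (𝓝 z₀)) :
    Tendsto (fun j => cmgf κ₀ (θ j) (z j / (√(N j) : ℝ)) ^ N j) atTop
      (𝓝 (Complex.exp (info k κ₀ * z₀ ^ 2 / 2))) := by
  have hs : Tendsto (fun j => √(N j : ℝ)) atTop atTop :=
    Real.tendsto_sqrt_atTop.comp (tendsto_natCast_atTop_atTop.comp hN)
  have hs' : Tendsto (fun j => (√(N j : ℝ))⁻¹) atTop (𝓝 0) := hs.inv_tendsto_atTop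
  have hzn : Tendsto (fun j => ‖z j / (√(N j) : ℝ)‖) atTop (𝓝 0) := by
    have := hz.norm.mul hs'
    rw [mul_zero] at this
    refine this.congr fun j => ?_
    rw [norm_div, Complex.norm_real, Real.norm_eq_abs, abs_of_nonneg (Real.sqrt_nonneg _),
      div_eq_mul_inv]
  have key : Tendsto (fun j => (N j : ℂ) * (cmgf κ₀ (θ j) (z j / (√(N j) : ℝ)) - 1)) atTop
      (𝓝 (info k κ₀ * z₀ ^ 2 / 2)) := by
    have h1 : Tendsto (fun j => (info k κ₀ : ℂ) * z j ^ 2 / 2) atTop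
        (𝓝 (info k κ₀ * z₀ ^ 2 / 2)) := ((hz.pow 2).const_mul _).div_const _
    refine tendsto_of_tendsto_of_dist h1 ?_
    have h2 : Tendsto (fun j => 8 * ‖z j‖ ^ 2 * ‖z j / (√(N j) : ℝ)‖) atTop (𝓝 0) := by
      simpa using ((hz.norm.pow 2).const_mul 8).mul hzn
    refine squeeze_zero' (Eventually.of_forall fun j => dist_nonneg) ?_ h2
    filter_upwards [hN.eventually_gt_atTop 0, hzn.eventually_le_const (u := 1 / 2) (by norm_num)]
      with j hj hj2
    have hNj : (0 : ℝ) < N j := by exact_mod_cast hj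
    have hsq : ((√(N j) : ℝ) : ℂ) ^ 2 = N j := by
      rw [← Complex.ofReal_pow, Real.sq_sqrt hNj.le, Complex.ofReal_natCast]
    have hNc : (N j : ℂ) ≠ 0 := by exact_mod_cast hj.ne'
    have hb := norm_cmgf_sub_le hk hκ₀ (θ j) hj2
    have e1 : (N j : ℂ) * (cmgf κ₀ (θ j) (z j / (√(N j) : ℝ)) - 1) - info k κ₀ * z j ^ 2 / 2 =
        N j * (cmgf κ₀ (θ j) (z j / (√(N j) : ℝ)) - 1 -
          (z j / (√(N j) : ℝ)) ^ 2 * info k κ₀ / 2) := by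
      rw [div_pow, hsq]
      field_simp
    have e2 : (N j : ℝ) * ‖z j / (√(N j) : ℝ)‖ ^ 2 = ‖z j‖ ^ 2 := by
      rw [norm_div, Complex.norm_real, div_pow, Real.norm_eq_abs, sq_abs, Real.sq_sqrt hNj.le]
      field_simp
    rw [dist_comm, dist_eq_norm, e1, norm_mul, Complex.norm_natCast, ← e2]
    calc (N j : ℝ) * _ ≤ N j * (8 * ‖z j / (√(N j) : ℝ)‖ ^ 3) :=
          mul_le_mul_of_nonneg_left hb hNj.le
      _ = _ := by ring
  have := tendsto_one_add_pow_exp_comp hN key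
  simpa using this

lemma cmgf_pow_eq_integral {k : ℕ} (κ₀ : ℝ) (θ : Sph k) (n : ℕ) (z : ℂ) :
    cmgf κ₀ θ (z / (√n : ℝ)) ^ n =
      ∫ x, Complex.exp (z * ((score κ₀ θ n x / √n : ℝ) : ℂ)) ∂(sampleLaw κ₀ θ n) := by
  rw [← integral_exp_score]
  refine integral_congr_ae (Eventually.of_forall fun x => ?_)
  simp only
  congr 1
  push_cast
  ring

lemma tendsto_integral_exp_score {k : ℕ} (hk : 2 ≤ k) {κ₀ : ℝ} (hκ₀ : κ₀ ≠ 0) {N : ℕ → ℕ}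
    (hN : Tendsto N atTop atTop) (θ : ℕ → Sph k) {a : ℕ → ℝ} {a₀ : ℝ}
    (ha : Tendsto a atTop (𝓝 a₀)) :
    Tendsto (fun j => ∫ x, Real.exp (a j * (score κ₀ (θ j) (N j) x / √(N j)))
      ∂(sampleLaw κ₀ (θ j) (N j))) atTop (𝓝 (Real.exp (info k κ₀ * a₀ ^ 2 / 2))) := by
  have ha' : Tendsto (fun j => (a j : ℂ)) atTop (𝓝 (a₀ : ℂ)) :=
    (Complex.continuous_ofReal.tendsto _).comp ha
  have h := tendsto_cmgf_pow hk hκ₀ hN θ ha'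
  have h' := (Complex.continuous_re.tendsto _).comp h
  have e1 : Complex.exp (info k κ₀ * (a₀ : ℂ) ^ 2 / 2) =
      ((Real.exp (info k κ₀ * a₀ ^ 2 / 2) : ℝ) : ℂ) := by push_cast; rfl
  rw [e1, Complex.ofReal_re] at h'
  refine h'.congr fun j => ?_
  rw [Function.comp_apply, cmgf_pow_eq_integral, ← Complex.ofReal_re (∫ x, Real.exp _ ∂_),
    ← integral_complex_ofReal]
  simp

lemma likelihoodRatio_nonneg {k : ℕ} (κ₀ c : ℝ) (θ : Sph k) (n : ℕ) (x : Fin n → Sph k) :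
    0 ≤ likelihoodRatio κ₀ c θ n x :=
  div_nonneg (Real.exp_pos _).le (integral_nonneg fun _ => (Real.exp_pos _).le)

lemma continuous_likelihoodRatio {k : ℕ} (κ₀ c : ℝ) (θ : Sph k) (n : ℕ) :
    Continuous (likelihoodRatio κ₀ c θ n) := by
  have := continuous_score κ₀ θ n
  unfold likelihoodRatio
  fun_prop

lemma integral_likelihoodRatio_sq {k : ℕ} (κ₀ c : ℝ) (θ : Sph k) (n : ℕ) :
    ∫ x, likelihoodRatio κ₀ c θ n x ^ 2 ∂(sampleLaw κ₀ θ n) =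
      (∫ x, Real.exp (2 * c * (score κ₀ θ n x / √n)) ∂(sampleLaw κ₀ θ n)) /
        (∫ x, Real.exp (c * (score κ₀ θ n x / √n)) ∂(sampleLaw κ₀ θ n)) ^ 2 := by
  rw [← integral_div]
  refine integral_congr_ae (Eventually.of_forall fun x => ?_)
  simp only [likelihoodRatio, div_pow]
  congr 1
  rw [← Real.exp_nat_mul]
  congr 1
  push_cast
  ring

/-- Contiguity of the local alternatives to the null distributions. -/
lemma tendsto_integral_local_of_null {k : ℕ} (hk : 2 ≤ k) {κ₀ : ℝ} (hκ₀ : κ₀ ≠ 0) {N : ℕ → ℕ}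
    (hN : Tendsto N atTop atTop) (θ : ℕ → Sph k) {c : ℕ → ℝ} {c₀ : ℝ}
    (hc : Tendsto c atTop (𝓝 c₀)) {f : ∀ j, (Fin (N j) → Sph k) → ℝ}
    (hf : ∀ j, Measurable (f j)) (hf0 : ∀ j x, 0 ≤ f j x) (hf1 : ∀ j x, f j x ≤ 1)
    (h : Tendsto (fun j => ∫ x, f j x ∂(sampleLaw κ₀ (θ j) (N j))) atTop (𝓝 0)) :
    Tendsto (fun j => ∫ x, f j x ∂(sampleLaw (κ₀ + c j / √(N j)) (θ j) (N j))) atTop (𝓝 0) := by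
  -- The limit of the second moment of the likelihood ratio; its boundedness is what yields
  -- contiguity.
  let B := Real.exp (info k κ₀ * (2 * c₀) ^ 2 / 2) / Real.exp (info k κ₀ * c₀ ^ 2 / 2) ^ 2
  have hB : 0 < B := by positivity
  have hsq : Tendsto (fun j => ∫ x, likelihoodRatio κ₀ (c j) (θ j) (N j) x ^ 2
      ∂(sampleLaw κ₀ (θ j) (N j))) atTop (𝓝 B) := by
    simp only [integral_likelihoodRatio_sq]
    exact (tendsto_integral_exp_score hk hκ₀ hN θ (hc.const_mul 2)).div
      ((tendsto_integral_exp_score hk hκ₀ hN θ hc).pow 2) (by positivity)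
  have hfi : ∀ (κ : ℝ) j, Integrable (f j) (sampleLaw κ (θ j) (N j)) := fun κ j =>
    Integrable.of_bound (hf j).aestronglyMeasurable 1
      (Eventually.of_forall fun x => by
        rw [Real.norm_eq_abs, abs_of_nonneg (hf0 j x)]; exact hf1 j x)
  rw [Metric.tendsto_atTop']
  intro ε hε
  let δ := ε / (2 * B)
  have hδ : 0 < δ := by positivity
  have hlim : Tendsto (fun j => δ / 2 * (∫ x, likelihoodRatio κ₀ (c j) (θ j) (N j) x ^ 2
      ∂(sampleLaw κ₀ (θ j) (N j))) + 1 / (2 * δ) * ∫ x, f j x ∂(sampleLaw κ₀ (θ j) (N j)))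
      atTop (𝓝 (δ / 2 * B + 1 / (2 * δ) * 0)) := (hsq.const_mul _).add (h.const_mul _)
  have hlt : δ / 2 * B + 1 / (2 * δ) * 0 < ε := by
    have : δ / 2 * B = ε / 4 := by simp only [δ]; field_simp; norm_num
    rw [this]; linarith
  obtain ⟨n, hn⟩ := eventually_atTop.1 (hlim.eventually_lt_const hlt)
  refine ⟨n, fun j hj => ?_⟩
  rw [Real.dist_0_eq_abs, abs_of_nonneg (integral_nonneg (hf0 j))]
  refine lt_of_le_of_lt ?_ (hn j hj.le)
  have hcont := continuous_likelihoodRatio κ₀ (c j) (θ j) (N j)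
  have hLi : Integrable (fun x => likelihoodRatio κ₀ (c j) (θ j) (N j) x ^ 2)
      (sampleLaw κ₀ (θ j) (N j)) := integrable_sampleLaw_of_continuous _ _ _ (by fun_prop)
  rw [integral_sampleLaw_local, ← integral_const_mul, ← integral_const_mul,
    ← integral_add (hLi.const_mul _) ((hfi _ j).const_mul _)]
  refine integral_mono_of_nonneg (Eventually.of_forall fun x =>
    mul_nonneg (likelihoodRatio_nonneg _ _ _ _ _) (hf0 j x))
    ((hLi.const_mul _).add ((hfi _ j).const_mul _)) (Eventually.of_forall fun x => ?_)
  simp only [smul_eq_mul]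
  set l := likelihoodRatio κ₀ (c j) (θ j) (N j) x
  have h1 : f j x ^ 2 ≤ f j x := by nlinarith [hf0 j x, hf1 j x]
  -- Weighted arithmetic-geometric mean inequality in place of Cauchy-Schwarz. The choice of `δ`
  -- makes the first term tend to `ε/4` in mean, while the second vanishes under the null because
  -- `f² ≤ f`.
  have h2 : l * f j x ≤ δ / 2 * l ^ 2 + 1 / (2 * δ) * f j x ^ 2 := by
    have : δ / 2 * l ^ 2 + 1 / (2 * δ) * f j x ^ 2 - l * f j x =
        (δ * l - f j x) ^ 2 / (2 * δ) := by field_simp; ring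
    have h3 : 0 ≤ (δ * l - f j x) ^ 2 / (2 * δ) := by positivity
    linarith
  have h3 : 1 / (2 * δ) * f j x ^ 2 ≤ 1 / (2 * δ) * f j x :=
    mul_le_mul_of_nonneg_left h1 (by positivity)
  linarith

/-- Asymptotic normality of the score under local alternatives, in terms of characteristic
functions. -/
lemma tendsto_charFun_score {k : ℕ} (hk : 2 ≤ k) {κ₀ : ℝ} (hκ₀ : κ₀ ≠ 0) {N : ℕ → ℕ}
    (hN : Tendsto N atTop atTop) (θ : ℕ → Sph k) {c : ℕ → ℝ} {c₀ : ℝ}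
    (hc : Tendsto c atTop (𝓝 c₀)) (t : ℝ) :
    Tendsto (fun j => ∫ x, Complex.exp (t * ((score κ₀ (θ j) (N j) x / √(N j) : ℝ) : ℂ) *
      Complex.I) ∂(sampleLaw (κ₀ + c j / √(N j)) (θ j) (N j))) atTop
      (𝓝 (charFun (gaussianReal (c₀ * info k κ₀) (info k κ₀).toNNReal) t)) := by
  -- The characteristic function under a tilt by `c` is the null moment generating function at `c +
  -- it` divided by its value at `c`.
  have hz : Tendsto (fun j => (c j : ℂ) + t * Complex.I) atTop (𝓝 (c₀ + t * Complex.I)) :=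
    ((Complex.continuous_ofReal.tendsto _).comp hc).add_const _
  have h1 := tendsto_cmgf_pow hk hκ₀ hN θ hz
  have h2 := (Complex.continuous_ofReal.tendsto _).comp
    (tendsto_integral_exp_score hk hκ₀ hN θ hc)
  have h3 := h1.div h2 (by exact_mod_cast (Real.exp_pos _).ne')
  have e1 : charFun (gaussianReal (c₀ * info k κ₀) (info k κ₀).toNNReal) t =
      Complex.exp (info k κ₀ * (c₀ + t * Complex.I) ^ 2 / 2) /
        ((Real.exp (info k κ₀ * c₀ ^ 2 / 2) : ℝ) : ℂ) := by
    rw [charFun_gaussianReal, Complex.ofReal_exp, ← Complex.exp_sub]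
    congr 1
    have : (((info k κ₀).toNNReal : ℝ) : ℂ) = info k κ₀ := by
      rw [Real.coe_toNNReal _ (info_pos hk hκ₀).le]
    rw [this]
    push_cast
    linear_combination (-(info k κ₀ : ℂ) * t ^ 2 / 2) * Complex.I_sq
  rw [e1]
  refine h3.congr fun j => ?_
  rw [Pi.div_apply, Function.comp_apply, integral_sampleLaw_local, cmgf_pow_eq_integral,
    ← integral_div]
  refine integral_congr_ae (Eventually.of_forall fun x => ?_)
  simp only [likelihoodRatio, Complex.real_smul]
  rw [add_mul, Complex.exp_add, Complex.ofReal_div (Real.exp _), div_mul_eq_mul_div]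
  congr 1
  push_cast
  ring_nf

/-! ### The effect of estimating the location. -/

/-- The deviation of the sum of the observations from its expectation under the null. -/
noncomputable def centeredSum {k : ℕ} (κ₀ : ℝ) (θ : Sph k) (n : ℕ) (x : Fin n → Sph k) :
    EuclideanSpace ℝ (Fin k) :=
  ∑ i, ((x i : EuclideanSpace ℝ (Fin k)) - A k κ₀ • (θ : EuclideanSpace ℝ (Fin k)))

lemma continuous_centeredSum {k : ℕ} (κ₀ : ℝ) (θ : Sph k) (n : ℕ) :
    Continuous (centeredSum κ₀ θ n) := by
  unfold centeredSum; fun_prop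

/-- Only the order `n`, uniformly in `θ`, matters. By `integral_inner_fvml` the summands are centred
in every direction, and each of the `k` coordinates has variance at most 1. -/
lemma integral_norm_centeredSum_sq_le {k : ℕ} (hk : 2 ≤ k) (κ₀ : ℝ) (θ : Sph k) (n : ℕ) :
    ∫ x, ‖centeredSum κ₀ θ n x‖ ^ 2 ∂(sampleLaw κ₀ θ n) ≤ n * k := by
  have hcs := continuous_centeredSum κ₀ θ n
  let Y : Fin k → Sph k → ℝ := fun j y => (y : EuclideanSpace ℝ (Fin k)) j -
    A k κ₀ * (θ : EuclideanSpace ℝ (Fin k)) j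
  have hYc : ∀ j, Continuous (Y j) := fun j => by fun_prop
  have hval : ∀ j (x : Fin n → Sph k), centeredSum κ₀ θ n x j = ∑ i, Y j (x i) := by
    intro j x
    simp [centeredSum, Y, Finset.sum_apply]
  have hcoord : ∀ j, ∫ y : Sph k, (y : EuclideanSpace ℝ (Fin k)) j ∂(fvml κ₀ θ) =
      A k κ₀ * (θ : EuclideanSpace ℝ (Fin k)) j := by
    intro j
    have := integral_inner_fvml hk κ₀ θ (EuclideanSpace.single j 1)
    simpa [EuclideanSpace.inner_single_right] using this
  have hmean : ∀ j, ∫ y, Y j y ∂(fvml κ₀ θ) = 0 := by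
    intro j
    rw [integral_sub (integrable_of_continuous _ (by fun_prop)) (integrable_const _), hcoord]
    simp
  have hmem : ∀ j, MemLp (Y j) 2 (fvml κ₀ θ) := fun j =>
    (memLp_two_iff_integrable_sq (hYc j).aestronglyMeasurable).2
      (integrable_of_continuous _ ((hYc j).pow 2))
  have hvar : ∀ j, Var[Y j; fvml κ₀ θ] ≤ 1 := by
    intro j
    have h1 : Var[Y j; fvml κ₀ θ] = Var[fun y : Sph k => (y : EuclideanSpace ℝ (Fin k)) j;
        fvml κ₀ θ] := variance_sub_const (by fun_prop) _
    rw [h1]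
    refine (variance_le_expectation_sq (by fun_prop)).trans ?_
    refine (integral_mono (integrable_of_continuous _ (by fun_prop)) (integrable_const 1)
      fun y => ?_).trans (by simp)
    have h2 : ‖(y : EuclideanSpace ℝ (Fin k)) j‖ ≤ ‖(y : EuclideanSpace ℝ (Fin k))‖ :=
      PiLp.norm_apply_le _ j
    have h3 : ‖(y : EuclideanSpace ℝ (Fin k))‖ = 1 := by simp
    rw [h3, Real.norm_eq_abs] at h2
    simpa using (sq_le_one_iff_abs_le_one _).2 h2
  have hj : ∀ j, ∫ x, (∑ i, Y j (x i)) ^ 2 ∂(sampleLaw κ₀ θ n) ≤ n := by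
    intro j
    have h1 : Var[∑ i, fun x : Fin n → Sph k => Y j (x i); sampleLaw κ₀ θ n] =
        ∑ i : Fin n, Var[Y j; fvml κ₀ θ] := variance_sum_pi fun _ => hmem j
    have h2 : ∫ x, (∑ i, fun x : Fin n → Sph k => Y j (x i)) x ∂(sampleLaw κ₀ θ n) = 0 := by
      simp only [Finset.sum_apply]
      rw [integral_finsetSum _ fun i _ => integrable_sampleLaw_of_continuous _ _ _ (by fun_prop)]
      refine Finset.sum_eq_zero fun i _ => ?_
      rw [sampleLaw, integral_comp_eval (μ := fun _ : Fin n => fvml κ₀ θ) (f := Y j)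
        (hYc j).aestronglyMeasurable, hmean]
    rw [variance_of_integral_eq_zero (by fun_prop) h2] at h1
    simp only [Finset.sum_apply] at h1
    rw [h1]
    refine (Finset.sum_le_sum fun i _ => hvar j).trans (by simp)
  have hnorm : ∀ x, ‖centeredSum κ₀ θ n x‖ ^ 2 = ∑ j, (∑ i, Y j (x i)) ^ 2 := by
    intro x
    rw [EuclideanSpace.real_norm_sq_eq]
    simp only [hval]
  simp only [hnorm]
  rw [integral_finsetSum _ fun j _ => integrable_sampleLaw_of_continuous _ _ _ (by fun_prop)]
  refine (Finset.sum_le_sum fun j _ => hj j).trans ?_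
  simp [mul_comm]

/-- Since `θ` and `e` are unit vectors, `θ'(e - θ) = -‖e - θ‖²/2`: the drift is quadratic in the
estimation error, so no first-order deterministic term survives. -/
lemma score_sub_score {k : ℕ} (κ₀ : ℝ) (θ e : Sph k) (n : ℕ) (x : Fin n → Sph k) :
    score κ₀ e n x - score κ₀ θ n x =
      ⟪centeredSum κ₀ θ n x,
        (e : EuclideanSpace ℝ (Fin k)) - (θ : EuclideanSpace ℝ (Fin k))⟫_ℝ -
      n * A k κ₀ * ‖(e : EuclideanSpace ℝ (Fin k)) - (θ : EuclideanSpace ℝ (Fin k))‖ ^ 2 / 2 := by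
  have h1 : ‖(θ : EuclideanSpace ℝ (Fin k))‖ = 1 := by simp
  have h2 : ‖(e : EuclideanSpace ℝ (Fin k))‖ = 1 := by simp
  rw [norm_sub_sq_real, h1, h2, centeredSum, sum_inner, score, score, ← Finset.sum_sub_distrib]
  simp only [inner_sub_left, inner_sub_right, real_inner_smul_left, real_inner_self_eq_norm_sq, h1,
    proj, Finset.sum_sub_distrib, Finset.sum_const, Finset.card_univ, Fintype.card_fin,
    nsmul_eq_mul, real_inner_comm (e : EuclideanSpace ℝ (Fin k)) (θ : EuclideanSpace ℝ (Fin k))]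
  ring

lemma abs_score_sub_score_le {k : ℕ} (hk : 2 ≤ k) (κ₀ : ℝ) (θ e : Sph k) {n : ℕ} (hn : 0 < n)
    (x : Fin n → Sph k) {u : ℝ}
    (hu : √n * ‖(e : EuclideanSpace ℝ (Fin k)) - (θ : EuclideanSpace ℝ (Fin k))‖ ≤ u) :
    |score κ₀ e n x / √n - score κ₀ θ n x / √n| ≤
      ‖centeredSum κ₀ θ n x‖ / n * u + u ^ 2 / (2 * √n) := by
  have hn' : (0 : ℝ) < n := by exact_mod_cast hn
  have hs : 0 < √(n : ℝ) := Real.sqrt_pos.2 hn'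
  set v := (e : EuclideanSpace ℝ (Fin k)) - (θ : EuclideanSpace ℝ (Fin k))
  set D := centeredSum κ₀ θ n x
  have hsq : √(n : ℝ) ^ 2 = n := Real.sq_sqrt hn'.le
  have hA := abs_A_le hk κ₀
  have hp : 0 ≤ √(n : ℝ) * ‖v‖ := by positivity
  rw [← sub_div, score_sub_score, abs_div, abs_of_pos hs, div_le_iff₀ hs]
  have h1 : |⟪D, v⟫_ℝ| ≤ ‖D‖ * ‖v‖ := abs_real_inner_le_norm _ _
  have h2 : |n * A k κ₀ * ‖v‖ ^ 2 / 2| ≤ n * ‖v‖ ^ 2 / 2 := by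
    rw [abs_div, abs_mul, abs_mul, abs_of_pos hn', abs_of_nonneg (by positivity : 0 ≤ ‖v‖ ^ 2),
      abs_two]
    have : (n : ℝ) * |A k κ₀| * ‖v‖ ^ 2 ≤ n * 1 * ‖v‖ ^ 2 := by gcongr
    linarith
  refine (abs_sub _ _).trans ((add_le_add h1 h2).trans ?_)
  have h3 : ‖D‖ * ‖v‖ ≤ ‖D‖ / n * u * √n := by
    calc ‖D‖ * ‖v‖ = ‖D‖ / n * (√n * ‖v‖) * √n := by
          field_simp; rw [hsq]
      _ ≤ _ := by gcongr
  have h4 : n * ‖v‖ ^ 2 / 2 ≤ u ^ 2 / (2 * √n) * √n := by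
    calc n * ‖v‖ ^ 2 / 2 = (√n * ‖v‖) ^ 2 / (2 * √n) * √n := by
          field_simp; rw [hsq]; ring
      _ ≤ _ := by gcongr
  linarith

lemma measureReal_centeredSum_le {k : ℕ} (hk : 2 ≤ k) (κ₀ : ℝ) (θ : Sph k) {n : ℕ} (hn : 0 < n)
    {η : ℝ} (hη : 0 < η) :
    (sampleLaw κ₀ θ n).real {x | η ≤ ‖centeredSum κ₀ θ n x‖ / n} ≤ k / (n * η ^ 2) := by
  have hn' : (0 : ℝ) < n := by exact_mod_cast hn
  have hcs := continuous_centeredSum κ₀ θ n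
  have h1 := mul_meas_ge_le_integral_of_nonneg (μ := sampleLaw κ₀ θ n)
    (f := fun x => ‖centeredSum κ₀ θ n x‖ ^ 2) (Eventually.of_forall fun x => by positivity)
    (integrable_sampleLaw_of_continuous _ _ _ (by fun_prop)) ((η * n) ^ 2)
  have h2 : {x | η ≤ ‖centeredSum κ₀ θ n x‖ / n} =
      {x | (η * n) ^ 2 ≤ ‖centeredSum κ₀ θ n x‖ ^ 2} := by
    ext x
    simp only [Set.mem_ofPred_eq]
    rw [le_div_iff₀ hn', sq_le_sq₀ (by positivity) (norm_nonneg _)]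
  rw [h2]
  have h3 := h1.trans (integral_norm_centeredSum_sq_le hk κ₀ θ n)
  rw [le_div_iff₀ (by positivity)]
  refine le_of_mul_le_mul_left ?_ hn'
  calc _ = (η * n) ^ 2 * (sampleLaw κ₀ θ n).real
        {x | (η * n) ^ 2 ≤ ‖centeredSum κ₀ θ n x‖ ^ 2} := by ring
    _ ≤ _ := h3

lemma measurable_estScore {k : ℕ} (κ₀ : ℝ) {n : ℕ} {e : (Fin n → Sph k) → Sph k}
    (he : Measurable e) : Measurable fun x => score κ₀ (e x) n x := by
  unfold score proj
  fun_prop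

/-- Replacing the location by a root-`n` consistent estimator does not change the score
asymptotically, under the null. -/
lemma tendsto_measureReal_score_sub {k : ℕ} (hk : 2 ≤ k) {κ₀ : ℝ}
    {est : ∀ n : ℕ, (Fin n → Sph k) → Sph k} {Θ : Set (Sph k)}
    (hest : RootNConsistentOn κ₀ Θ est) {N : ℕ → ℕ} (hN : Tendsto N atTop atTop)
    {θ : ℕ → Sph k} (hθ : ∀ j, θ j ∈ Θ) {δ : ℝ} (hδ : 0 < δ) :
    Tendsto (fun j => (sampleLaw κ₀ (θ j) (N j)).real
      {x | δ < |score κ₀ (est (N j) x) (N j) x / √(N j) - score κ₀ (θ j) (N j) x / √(N j)|})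
      atTop (𝓝 0) := by
  rw [Metric.tendsto_atTop']
  intro ε hε
  obtain ⟨C₀, hC₀⟩ := hest (ε / 2) (by positivity)
  -- The constant in the consistency condition may be nonpositive; the maximum allows division by it
  -- in `η`.
  set C := max C₀ 1
  have hC : 0 < C := lt_of_lt_of_le one_pos (le_max_right _ _)
  let η := δ / (2 * C)
  have hη : 0 < η := by positivity
  have hNr : Tendsto (fun j => (N j : ℝ)) atTop atTop := tendsto_natCast_atTop_atTop.comp hN
  have hs : Tendsto (fun j => √(N j : ℝ)) atTop atTop := Real.tendsto_sqrt_atTop.comp hNr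
  have h1 : Tendsto (fun j => (k : ℝ) / ((N j : ℝ) * η ^ 2)) atTop (𝓝 0) :=
    Tendsto.div_atTop tendsto_const_nhds (hNr.atTop_mul_const (by positivity))
  have h2 : Tendsto (fun j => C ^ 2 / (2 * √(N j : ℝ))) atTop (𝓝 0) :=
    Tendsto.div_atTop tendsto_const_nhds (hs.const_mul_atTop (by norm_num))
  obtain ⟨n, hn⟩ := eventually_atTop.1 ((hN.eventually hC₀).and ((h1.eventually_lt_const
    (show 0 < ε / 2 by positivity)).and ((h2.eventually_lt_const
    (show 0 < δ / 2 by positivity)).and (hN.eventually_gt_atTop 0))))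
  refine ⟨n, fun j hj => ?_⟩
  obtain ⟨a1, a2, a3, a4⟩ := hn j hj.le
  rw [Real.dist_0_eq_abs, abs_of_nonneg measureReal_nonneg]
  have hsub : {x | δ < |score κ₀ (est (N j) x) (N j) x / √(N j) -
      score κ₀ (θ j) (N j) x / √(N j)|} ⊆
      {x | C₀ < √(N j) * ‖(est (N j) x : EuclideanSpace ℝ (Fin k)) -
        (θ j : EuclideanSpace ℝ (Fin k))‖} ∪ {x | η ≤ ‖centeredSum κ₀ (θ j) (N j) x‖ / N j} := by
    intro x hx
    by_contra hcon
    simp only [Set.mem_union, Set.mem_ofPred_eq, not_or, not_lt, not_le] at hcon hx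
    have h3 := abs_score_sub_score_le hk κ₀ (θ j) (est (N j) x) a4 x
      (hcon.1.trans (le_max_left C₀ 1))
    have h4 : ‖centeredSum κ₀ (θ j) (N j) x‖ / N j * C ≤ η * C := by gcongr; exact hcon.2.le
    have h5 : η * C = δ / 2 := by simp only [η]; field_simp
    change _ ≤ _ / _ * C + C ^ 2 / _ at h3
    linarith
  calc _ ≤ _ := measureReal_mono hsub
    _ ≤ _ := measureReal_union_le _ _
    _ ≤ ε / 2 + k / (N j * η ^ 2) :=
        add_le_add (a1 _ (hθ j)) (measureReal_centeredSum_le hk κ₀ _ a4 hη)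
    _ < ε := by linarith

/-- Asymptotic normality, under local alternatives, of the score with estimated location. -/
lemma tendsto_charFun_estScore {k : ℕ} (hk : 2 ≤ k) {κ₀ : ℝ} (hκ₀ : κ₀ ≠ 0)
    {est : ∀ n : ℕ, (Fin n → Sph k) → Sph k} (hmeas : ∀ n, Measurable (est n)) {Θ : Set (Sph k)}
    (hest : RootNConsistentOn κ₀ Θ est) {N : ℕ → ℕ} (hN : Tendsto N atTop atTop)
    {θ : ℕ → Sph k} (hθ : ∀ j, θ j ∈ Θ) {c : ℕ → ℝ} {c₀ : ℝ} (hc : Tendsto c atTop (𝓝 c₀))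
    (t : ℝ) :
    Tendsto (fun j => charFun ((sampleLaw (κ₀ + c j / √(N j)) (θ j) (N j)).map
      fun x => score κ₀ (est (N j) x) (N j) x / √(N j)) t) atTop
      (𝓝 (charFun (gaussianReal (c₀ * info k κ₀) (info k κ₀).toNNReal) t)) := by
  have hm : ∀ n, Measurable fun x => score κ₀ (est n x) n x / √n := fun n =>
    (measurable_estScore κ₀ (hmeas n)).div_const _
  have hm' : ∀ n (τ : Sph k), Measurable fun x => score κ₀ τ n x / √n := fun n τ => by fun_prop
  refine tendsto_of_tendsto_of_dist (tendsto_charFun_score hk hκ₀ hN θ hc t) ?_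
  let R : ∀ j, (Fin (N j) → Sph k) → ℝ := fun j x =>
    score κ₀ (est (N j) x) (N j) x / √(N j) - score κ₀ (θ j) (N j) x / √(N j)
  have hR : ∀ j, Measurable (R j) := fun j => (hm _).sub (hm' _ _)
  -- Half the modulus `|e^{itR} - 1|` lies in `[0, 1]`, as the contiguity lemma demands, and twice
  -- its integral bounds the difference of the two characteristic functions.
  let f : ∀ j, (Fin (N j) → Sph k) → ℝ := fun j x =>
    ‖Complex.exp (((t * R j x : ℝ) : ℂ) * Complex.I) - 1‖ / 2
  have hfm : ∀ j, Measurable (f j) := fun j => by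
    have := hR j
    fun_prop
  have hf0 : ∀ j x, 0 ≤ f j x := fun j x => by positivity
  have hf1 : ∀ j x, f j x ≤ 1 := fun j x => by
    have h1 := norm_sub_le (Complex.exp (((t * R j x : ℝ) : ℂ) * Complex.I)) 1
    rw [Complex.norm_exp_ofReal_mul_I, norm_one] at h1
    simp only [f]
    linarith
  have hfR : ∀ j x, f j x ≤ |t| * |R j x| := fun j x => by
    have h1 := Real.norm_exp_I_mul_ofReal_sub_one_le (x := t * R j x)
    rw [mul_comm Complex.I, Real.norm_eq_abs, abs_mul] at h1
    have : 0 ≤ |t| * |R j x| := by positivity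
    simp only [f]
    linarith
  have hfi : ∀ (κ : ℝ) j, Integrable (f j) (sampleLaw κ (θ j) (N j)) := fun κ j =>
    Integrable.of_bound (hfm j).aestronglyMeasurable 1
      (Eventually.of_forall fun x => by
        rw [Real.norm_eq_abs, abs_of_nonneg (hf0 j x)]; exact hf1 j x)
  have hnull : Tendsto (fun j => ∫ x, f j x ∂(sampleLaw κ₀ (θ j) (N j))) atTop (𝓝 0) := by
    rw [Metric.tendsto_atTop']
    intro ε hε
    let δ := ε / (2 * (|t| + 1))
    have hδ : 0 < δ := by positivity
    have hδt : |t| * δ ≤ ε / 2 := by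
      have : (|t| + 1) * δ = ε / 2 := by simp only [δ]; field_simp
      nlinarith
    obtain ⟨n, hn⟩ := eventually_atTop.1 ((tendsto_measureReal_score_sub hk hest hN hθ
      hδ).eventually_lt_const (show 0 < ε / 2 by positivity))
    refine ⟨n, fun j hj => ?_⟩
    rw [Real.dist_0_eq_abs, abs_of_nonneg (integral_nonneg (hf0 j))]
    have hset : MeasurableSet {x | δ < |R j x|} :=
      measurableSet_lt measurable_const (hR j).abs
    have hle : ∀ x, f j x ≤ |t| * δ + {x | δ < |R j x|}.indicator (fun _ => (1 : ℝ)) x := by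
      intro x
      by_cases hx : δ < |R j x|
      · rw [Set.indicator_of_mem (by exact hx)]
        have : 0 ≤ |t| * δ := by positivity
        linarith [hf1 j x]
      · rw [Set.indicator_of_notMem (by exact hx), add_zero]
        exact (hfR j x).trans (mul_le_mul_of_nonneg_left (not_lt.1 hx) (abs_nonneg _))
    have hi2 : Integrable ({x | δ < |R j x|}.indicator fun _ => (1 : ℝ))
        (sampleLaw κ₀ (θ j) (N j)) := (integrable_const 1).indicator hset
    calc _ ≤ ∫ x, (|t| * δ + {x | δ < |R j x|}.indicator (fun _ => (1 : ℝ)) x)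
          ∂(sampleLaw κ₀ (θ j) (N j)) := integral_mono (hfi _ j)
            ((integrable_const _).add hi2) hle
      _ = |t| * δ + (sampleLaw κ₀ (θ j) (N j)).real {x | δ < |R j x|} := by
          rw [integral_add (integrable_const _) hi2, integral_indicator hset]
          simp
      _ < ε := by
          have := hn j hj.le
          change (sampleLaw κ₀ (θ j) (N j)).real {x | δ < |R j x|} < ε / 2 at this
          linarith
  have halt := (tendsto_integral_local_of_null hk hκ₀ hN θ hc hfm hf0 hf1 hnull).const_mul 2
  rw [mul_zero] at halt
  refine squeeze_zero (fun j => dist_nonneg) (fun j => ?_) halt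
  have hnorm1 : ∀ y : ℝ, ‖Complex.exp (t * (y : ℂ) * Complex.I)‖ = 1 := fun y => by
    rw [← Complex.ofReal_mul, Complex.norm_exp_ofReal_mul_I]
  have hint : ∀ {g : (Fin (N j) → Sph k) → ℝ}, Measurable g →
      Integrable (fun x => Complex.exp (t * ((g x : ℝ) : ℂ) * Complex.I))
        (sampleLaw (κ₀ + c j / √(N j)) (θ j) (N j)) := fun hg =>
    Integrable.of_bound (by fun_prop : Measurable _).aestronglyMeasurable 1
      (Eventually.of_forall fun x => (hnorm1 _).le)
  rw [charFun_apply_real, integral_map (hm _).aemeasurable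
    (by fun_prop : Measurable _).aestronglyMeasurable, dist_comm, dist_eq_norm,
    ← integral_sub (hint (hm _)) (hint (hm' _ _)), ← integral_const_mul]
  refine norm_integral_le_of_norm_le ((hfi _ j).const_mul 2) (Eventually.of_forall fun x => ?_)
  have e1 : Complex.exp (t * ((score κ₀ (est (N j) x) (N j) x / √(N j) : ℝ) : ℂ) * Complex.I) -
      Complex.exp (t * ((score κ₀ (θ j) (N j) x / √(N j) : ℝ) : ℂ) * Complex.I) =
      Complex.exp (t * ((score κ₀ (θ j) (N j) x / √(N j) : ℝ) : ℂ) * Complex.I) *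
        (Complex.exp (((t * R j x : ℝ) : ℂ) * Complex.I) - 1) := by
    rw [mul_sub, ← Complex.exp_add, mul_one]
    congr 2
    simp only [R]
    push_cast
    ring
  rw [e1, norm_mul, hnorm1, one_mul]
  simp only [f]
  linarith

/-! ### The chi-square limit of the statistic and its quantile. -/

lemma map_gaussianReal_sq_div {v : ℝ} (hv : 0 < v) (c : ℝ) :
    (gaussianReal (c * v) v.toNNReal).map (fun w => w ^ 2 / v) = chiSqOne (v * c ^ 2) := by
  have hs : 0 < √v := Real.sqrt_pos.2 hv
  have hsq : √v ^ 2 = v := Real.sq_sqrt hv.le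
  -- Standardize by `±1/√v` with the sign of `c`, so that the mean becomes the nonnegative root used
  -- in `chiSqOne`; squaring forgets the sign.
  obtain ⟨s, hs2, hsc⟩ : ∃ s : ℝ, s ^ 2 = v⁻¹ ∧ s * (c * v) = √(v * c ^ 2) := by
    have h1 : √(v * c ^ 2) = √v * |c| := by
      rw [Real.sqrt_mul hv.le, Real.sqrt_sq_eq_abs]
    rcases le_total 0 c with hc | hc
    · refine ⟨(√v)⁻¹, by rw [inv_pow, hsq], ?_⟩
      rw [h1, abs_of_nonneg hc]
      field_simp
      rw [hsq, mul_comm]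
    · refine ⟨-(√v)⁻¹, by rw [neg_sq, inv_pow, hsq], ?_⟩
      rw [h1, abs_of_nonpos hc]
      field_simp
      rw [hsq]
      ring
  have h1 : (fun w : ℝ => w ^ 2 / v) = (fun z => z ^ 2) ∘ (fun w => s * w) := by
    ext w
    simp only [Function.comp_apply, mul_pow, hs2]
    ring
  rw [h1, ← Measure.map_map (by fun_prop) (by fun_prop), gaussianReal_map_const_mul, chiSqOne, hsc]
  congr 2
  ext
  simp [hs2, Real.coe_toNNReal _ hv.le, hv.ne']

lemma scoreStat_eq {k : ℕ} (κ₀ : ℝ) (est : ∀ n : ℕ, (Fin n → Sph k) → Sph k) (n : ℕ)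
    (x : Fin n → Sph k) :
    scoreStat κ₀ est n x = (score κ₀ (est n x) n x / √n) ^ 2 / info k κ₀ := by
  rw [div_pow, Real.sq_sqrt (Nat.cast_nonneg n), div_div]
  rfl

lemma measurable_scoreStat {k : ℕ} (κ₀ : ℝ) {est : ∀ n : ℕ, (Fin n → Sph k) → Sph k}
    (hmeas : ∀ n, Measurable (est n)) (n : ℕ) : Measurable (scoreStat κ₀ est n) := by
  have h : scoreStat κ₀ est n = fun x => (score κ₀ (est n x) n x / √n) ^ 2 / info k κ₀ :=
    funext fun x => scoreStat_eq κ₀ est n x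
  rw [h]
  exact (((measurable_estScore κ₀ (hmeas n)).div_const _).pow_const 2).div_const _

/-- Asymptotic distribution of the score statistic along sequences of local alternatives and of
locations. -/
lemma tendstoInDistribution_scoreStat {k : ℕ} (hk : 2 ≤ k) {κ₀ : ℝ} (hκ₀ : κ₀ ≠ 0)
    {est : ∀ n : ℕ, (Fin n → Sph k) → Sph k} (hmeas : ∀ n, Measurable (est n)) {Θ : Set (Sph k)}
    (hest : RootNConsistentOn κ₀ Θ est) {N : ℕ → ℕ} (hN : Tendsto N atTop atTop)
    {θ : ℕ → Sph k} (hθ : ∀ j, θ j ∈ Θ) {c : ℕ → ℝ} {c₀ : ℝ} (hc : Tendsto c atTop (𝓝 c₀)) :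
    TendstoInDistribution (fun j => scoreStat κ₀ est (N j)) atTop id
      (fun j => sampleLaw (κ₀ + c j / √(N j)) (θ j) (N j)) (chiSqOne (info k κ₀ * c₀ ^ 2)) := by
  have hm : ∀ n, Measurable fun x => score κ₀ (est n x) n x / √n := fun n =>
    (measurable_estScore κ₀ (hmeas n)).div_const _
  have h1 : TendstoInDistribution (fun j x => score κ₀ (est (N j) x) (N j) x / √(N j)) atTop
      (id : ℝ → ℝ) (fun j => sampleLaw (κ₀ + c j / √(N j)) (θ j) (N j))
      (gaussianReal (c₀ * info k κ₀) (info k κ₀).toNNReal) := by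
    refine ⟨fun j => (hm _).aemeasurable, aemeasurable_id, ?_⟩
    refine ProbabilityMeasure.tendsto_of_tendsto_charFun fun t => ?_
    simp only [ProbabilityMeasure.coe_mk, Measure.map_id]
    exact tendsto_charFun_estScore hk hκ₀ hmeas hest hN hθ hc t
  have h2 := h1.continuous_comp (g := fun w => w ^ 2 / info k κ₀) (by fun_prop)
  have h3 : ∀ j, (fun w => w ^ 2 / info k κ₀) ∘
      (fun x => score κ₀ (est (N j) x) (N j) x / √(N j)) = scoreStat κ₀ est (N j) :=
    fun j => funext fun x => (scoreStat_eq κ₀ est _ x).symm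
  simp only [h3] at h2
  refine ⟨h2.forall_aemeasurable, aemeasurable_id, ?_⟩
  have h4 := h2.tendsto
  have h5 : (gaussianReal (c₀ * info k κ₀) (info k κ₀).toNNReal).map
      ((fun w => w ^ 2 / info k κ₀) ∘ id) = (chiSqOne (info k κ₀ * c₀ ^ 2)).map id := by
    rw [Function.comp_id, Measure.map_id, map_gaussianReal_sq_div (info_pos hk hκ₀)]
  convert! h4 using 2
  exact congrArg 𝓝 (Subtype.ext h5.symm)

instance nullSingletonClass_chiSqOne (lam : ℝ) : NullSingletonClass (chiSqOne lam) := by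
  refine ⟨fun q => ?_⟩
  have : NullSingletonClass (gaussianReal (√lam) 1) := nullSingletonClass_gaussianReal one_ne_zero
  rw [chiSqOne, Measure.map_apply (by fun_prop) (measurableSet_singleton q)]
  refine Set.Finite.measure_zero (Set.Finite.subset (Set.toFinite {√q, -√q}) fun z hz => ?_) _
  have hz' : z ^ 2 = q := hz
  have : |z| = √q := by rw [← hz', Real.sqrt_sq_eq_abs]
  simpa using eq_or_eq_neg_of_abs_eq this

lemma continuous_cdf {μ : Measure ℝ} [IsProbabilityMeasure μ] [NullSingletonClass μ] :
    Continuous (cdf μ) := by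
  refine continuous_iff_continuousAt.2 fun x => ?_
  rw [(monotone_cdf μ).continuousAt_iff_leftLim_eq_rightLim, StieltjesFunction.rightLim_eq]
  have h := (cdf μ).measure_singleton x
  rw [measure_cdf, measure_singleton, eq_comm, ENNReal.ofReal_eq_zero] at h
  exact le_antisymm ((monotone_cdf μ).leftLim_le le_rfl) (by linarith)

/-- Without atoms the distribution function is continuous: the infimum is attained and the level `1
- α` is hit exactly, so the limiting size is exactly `α`. -/
lemma measureReal_Ioi_upperQuantile {μ : Measure ℝ} [IsProbabilityMeasure μ]
    [NullSingletonClass μ] {α : ℝ} (h0 : 0 < α) (h1 : α < 1) :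
    μ.real (Set.Ioi (upperQuantile μ α)) = α := by
  have hc : Continuous (cdf μ) := continuous_cdf
  set S := {x : ℝ | 1 - α ≤ cdf μ x} with hS
  obtain ⟨a, ha⟩ : ∃ a, cdf μ a < 1 - α :=
    ((tendsto_cdf_atBot μ).eventually_lt_const (by linarith)).exists
  obtain ⟨b, hb⟩ : ∃ b, 1 - α < cdf μ b :=
    ((tendsto_cdf_atTop μ).eventually_const_lt (by linarith)).exists
  have hbdd : BddBelow S := ⟨a, fun x hx => by
    by_contra hxa
    have := monotone_cdf μ (not_le.1 hxa).le
    simp only [hS, Set.mem_ofPred_eq] at hx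
    linarith⟩
  have hcl : IsClosed S := isClosed_le continuous_const hc
  have hmem : upperQuantile μ α ∈ S := hcl.csInf_mem ⟨b, hb.le⟩ hbdd
  obtain ⟨x, hx⟩ : ∃ x, cdf μ x = 1 - α := by
    have := mem_range_of_exists_le_of_exists_ge hc ⟨a, ha.le⟩ ⟨b, hb.le⟩
    exact this
  have hle : upperQuantile μ α ≤ x := csInf_le hbdd (by simp [hx])
  have h2 : cdf μ (upperQuantile μ α) = 1 - α :=
    le_antisymm (hx ▸ monotone_cdf μ hle) hmem
  rw [← Set.compl_Iic, probReal_compl_eq_one_sub measurableSet_Iic, ← cdf_eq_real, h2]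
  ring

lemma upperQuantile_chiSqOne_nonneg {α : ℝ} (h0 : 0 < α) (h1 : α < 1) :
    0 ≤ upperQuantile (chiSqOne 0) α := by
  by_contra h
  have h2 := measureReal_Ioi_upperQuantile (μ := chiSqOne 0) h0 h1
  have h3 : (chiSqOne 0).real (Set.Ioi (upperQuantile (chiSqOne 0) α)) = 1 := by
    rw [chiSqOne, map_measureReal_apply (by fun_prop) measurableSet_Ioi]
    have : (fun z : ℝ => z ^ 2) ⁻¹' Set.Ioi (upperQuantile (chiSqOne 0) α) = Set.univ := by
      refine Set.eq_univ_of_forall fun z => ?_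
      exact (not_le.1 h).trans_le (sq_nonneg z)
    unfold chiSqOne at this
    rw [this, probReal_univ]
  linarith

lemma power_scoreTest {k : ℕ} {κ₀ : ℝ} {est : ∀ n : ℕ, (Fin n → Sph k) → Sph k}
    (hmeas : ∀ n, Measurable (est n)) (α κ : ℝ) (θ : Sph k) (n : ℕ) :
    power (scoreTest κ₀ est α) κ θ n = ((sampleLaw κ θ n).map (scoreStat κ₀ est n)).real
      (Set.Ioi (upperQuantile (chiSqOne 0) α)) := by
  have hm := measurable_scoreStat κ₀ hmeas n
  rw [power, map_measureReal_apply hm measurableSet_Ioi, scoreTest,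
    integral_indicator (measurableSet_lt measurable_const hm)]
  simp
  rfl

/-! ### Uniform convergence and monotonicity of the power. -/

/-- The limiting power of the score test. -/
noncomputable def limitPower (k : ℕ) (κ₀ α c : ℝ) : ℝ :=
  (chiSqOne (info k κ₀ * c ^ 2)).real (Set.Ioi (upperQuantile (chiSqOne 0) α))

lemma tendsto_power_scoreTest_seq {k : ℕ} (hk : 2 ≤ k) {κ₀ : ℝ} (hκ₀ : κ₀ ≠ 0)
    {est : ∀ n : ℕ, (Fin n → Sph k) → Sph k} (hmeas : ∀ n, Measurable (est n)) {Θ : Set (Sph k)}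
    (hest : RootNConsistentOn κ₀ Θ est) (α : ℝ) {N : ℕ → ℕ} (hN : Tendsto N atTop atTop)
    {θ : ℕ → Sph k} (hθ : ∀ j, θ j ∈ Θ) {c : ℕ → ℝ} {c₀ : ℝ} (hc : Tendsto c atTop (𝓝 c₀)) :
    Tendsto (fun j => power (scoreTest κ₀ est α) (κ₀ + c j / √(N j)) (θ j) (N j)) atTop
      (𝓝 (limitPower k κ₀ α c₀)) := by
  have h := tendstoInDistribution_scoreStat hk hκ₀ hmeas hest hN hθ hc
  have h1 := ProbabilityMeasure.tendsto_measure_of_null_frontier_of_tendsto' h.tendsto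
    (E := Set.Ioi (upperQuantile (chiSqOne 0) α)) (by simp)
  simp only [ProbabilityMeasure.coe_mk, Measure.map_id] at h1
  have h2 := (ENNReal.tendsto_toReal (measure_ne_top _ _)).comp h1
  simp only [power_scoreTest hmeas]
  exact h2

/-- Convergence of the power, locally uniformly in the local parameter and uniformly over the
locations. -/
lemma tendsto_power_scoreTest {k : ℕ} (hk : 2 ≤ k) {κ₀ : ℝ} (hκ₀ : κ₀ ≠ 0)
    {est : ∀ n : ℕ, (Fin n → Sph k) → Sph k} (hmeas : ∀ n, Measurable (est n)) {Θ : Set (Sph k)}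
    (hest : RootNConsistentOn κ₀ Θ est) (α c₀ : ℝ) :
    Tendsto (fun p : (ℕ × ℝ) × Θ =>
      power (scoreTest κ₀ est α) (κ₀ + p.1.2 / √p.1.1) (p.2 : Sph k) p.1.1)
      ((atTop ×ˢ 𝓝 c₀) ×ˢ ⊤) (𝓝 (limitPower k κ₀ α c₀)) := by
  -- The filter `⊤` on `Θ` expresses uniformity in the location. The product filter is countably
  -- generated, so arbitrary sequences `(N j, c j, θ j)` suffice.
  refine tendsto_of_seq_tendsto fun u hu => ?_
  have h1 : Tendsto (fun j => (u j).1) atTop (atTop ×ˢ 𝓝 c₀) := tendsto_fst.comp hu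
  exact tendsto_power_scoreTest_seq hk hκ₀ hmeas hest α (tendsto_fst.comp h1)
    (fun j => (u j).2.2) (tendsto_snd.comp h1)

/-- Compactness of `K` upgrades the locally uniform convergence in `c` to a bound valid on all of
`K` from one sample size on. -/
lemma eventually_power_scoreTest {k : ℕ} (hk : 2 ≤ k) {κ₀ : ℝ} (hκ₀ : κ₀ ≠ 0)
    {est : ∀ n : ℕ, (Fin n → Sph k) → Sph k} (hmeas : ∀ n, Measurable (est n)) {Θ : Set (Sph k)}
    (hest : RootNConsistentOn κ₀ Θ est) (α : ℝ) {K : Set ℝ} (hK : IsCompact K) {β : ℝ}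
    (hβ : ∀ c ∈ K, β < limitPower k κ₀ α c) :
    ∀ᶠ n : ℕ in atTop, ∀ c ∈ K, ∀ θ ∈ Θ,
      β < power (scoreTest κ₀ est α) (κ₀ + c / √n) θ n := by
  let s : Set (ℕ × ℝ) := {p | ∀ θ : Θ,
    β < power (scoreTest κ₀ est α) (κ₀ + p.2 / √p.1) (θ : Sph k) p.1}
  have hs : s ∈ atTop ×ˢ 𝓝ˢ K := by
    refine hK.mem_prod_nhdsSet_of_forall fun c hc => ?_
    have := (tendsto_power_scoreTest hk hκ₀ hmeas hest α c).eventually_const_lt (hβ c hc)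
    rw [eventually_prod_iff] at this
    obtain ⟨pa, hpa, pb, hpb, h⟩ := this
    filter_upwards [hpa] with p hp θ
    exact h hp ((eventually_top.1 hpb) θ)
  rw [mem_prod_iff] at hs
  obtain ⟨t, ht, v, hv, htv⟩ := hs
  filter_upwards [ht] with n hn c hc θ hθ
  exact htv (Set.mk_mem_prod hn (subset_of_mem_nhdsSet hv hc)) ⟨θ, hθ⟩

lemma gaussianReal_real_Icc (m s : ℝ) (hs : 0 ≤ s) :
    (gaussianReal m 1).real (Set.Icc (-s) s) =
      ∫ x in (-s - m)..(s - m), gaussianPDFReal 0 1 x := by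
  rw [measureReal_def, gaussianReal_apply_eq_integral _ one_ne_zero,
    ENNReal.toReal_ofReal (integral_nonneg fun x => gaussianPDFReal_nonneg _ _ _),
    integral_Icc_eq_integral_Ioc, ← intervalIntegral.integral_of_le (by linarith),
    ← intervalIntegral.integral_comp_sub_right (fun x => gaussianPDFReal 0 1 x)]
  simp [gaussianPDFReal]

lemma continuous_gaussianPDFReal : Continuous (gaussianPDFReal 0 1) := by
  unfold gaussianPDFReal
  fun_prop

/-- The mass that a normal distribution gives to a symmetric interval decreases with the distance
of its mean from the origin. -/
lemma antitoneOn_gaussianReal_Icc {s : ℝ} (hs : 0 ≤ s) :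
    AntitoneOn (fun m => (gaussianReal m 1).real (Set.Icc (-s) s)) (Set.Ici 0) := by
  have hp := continuous_gaussianPDFReal
  have hd : ∀ m, HasDerivAt (fun m => (gaussianReal m 1).real (Set.Icc (-s) s))
      (gaussianPDFReal 0 1 (-s - m) - gaussianPDFReal 0 1 (s - m)) m := by
    intro m
    let P : ℝ → ℝ := fun y => ∫ x in (0 : ℝ)..y, gaussianPDFReal 0 1 x
    have hP : ∀ y, HasDerivAt P (gaussianPDFReal 0 1 y) y := fun y =>
      intervalIntegral.integral_hasDerivAt_right (hp.intervalIntegrable _ _)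
        (hp.stronglyMeasurableAtFilter _ _) hp.continuousAt
    have h1 : (fun m => (gaussianReal m 1).real (Set.Icc (-s) s)) =
        fun m => P (s - m) - P (-s - m) := by
      ext m
      rw [gaussianReal_real_Icc m s hs]
      exact (intervalIntegral.integral_interval_sub_left (hp.intervalIntegrable _ _)
        (hp.intervalIntegrable _ _)).symm
    rw [h1]
    have h2 : HasDerivAt (fun m : ℝ => s - m) (-1) m := by
      simpa using (hasDerivAt_id m).const_sub s
    have h3 : HasDerivAt (fun m : ℝ => -s - m) (-1) m := by
      simpa using (hasDerivAt_id m).const_sub (-s)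
    convert! ((hP (s - m)).comp m h2).sub ((hP (-s - m)).comp m h3) using 1
    ring
  refine antitoneOn_of_deriv_nonpos (convex_Ici 0)
    (fun m _ => (hd m).continuousAt.continuousWithinAt)
    (fun m _ => (hd m).differentiableAt.differentiableWithinAt) fun m hm => ?_
  rw [interior_Ici] at hm
  rw [(hd m).deriv, sub_nonpos]
  simp only [gaussianPDFReal]
  have : (s - m - 0) ^ 2 ≤ (-s - m - 0) ^ 2 := by nlinarith [Set.mem_Ioi.1 hm]
  gcongr

lemma chiSqOne_real_Ioi {q : ℝ} (hq : 0 ≤ q) (lam : ℝ) :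
    (chiSqOne lam).real (Set.Ioi q) = 1 - (gaussianReal (√lam) 1).real (Set.Icc (-√q) √q) := by
  rw [chiSqOne, map_measureReal_apply (by fun_prop) measurableSet_Ioi,
    ← probReal_compl_eq_one_sub measurableSet_Icc]
  congr 1
  ext z
  simp only [Set.mem_preimage, Set.mem_Ioi, Set.mem_compl_iff, Set.mem_Icc]
  rw [← abs_le, not_le, ← Real.sqrt_sq_eq_abs, Real.sqrt_lt_sqrt_iff hq]

lemma limitPower_mono {k : ℕ} (hk : 2 ≤ k) {κ₀ : ℝ} (hκ₀ : κ₀ ≠ 0) {α : ℝ} (h0 : 0 < α)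
    (h1 : α < 1) {b c : ℝ} (hb : 0 ≤ b) (hbc : b ≤ |c|) :
    limitPower k κ₀ α b ≤ limitPower k κ₀ α c := by
  have hq := upperQuantile_chiSqOne_nonneg h0 h1
  rw [limitPower, limitPower, chiSqOne_real_Ioi hq, chiSqOne_real_Ioi hq]
  refine sub_le_sub_left (antitoneOn_gaussianReal_Icc (Real.sqrt_nonneg _)
    (Set.mem_Ici.2 (Real.sqrt_nonneg _)) (Set.mem_Ici.2 (Real.sqrt_nonneg _)) ?_) _
  refine Real.sqrt_le_sqrt (mul_le_mul_of_nonneg_left ?_ (info_pos hk hκ₀).le)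
  rw [← sq_abs c]
  gcongr

lemma limitPower_zero {k : ℕ} {κ₀ α : ℝ} (h0 : 0 < α) (h1 : α < 1) :
    limitPower k κ₀ α 0 = α := by
  rw [limitPower, zero_pow two_ne_zero, mul_zero]
  exact measureReal_Ioi_upperQuantile h0 h1

/-! ### Bounds on the minimum power. -/

lemma integrable_test {k : ℕ} {φ : ∀ n : ℕ, (Fin n → Sph k) → ℝ} (hφ : IsTestSeq φ) (κ : ℝ)
    (θ : Sph k) (n : ℕ) : Integrable (φ n) (sampleLaw κ θ n) :=
  Integrable.of_bound (hφ n).1.aestronglyMeasurable 1 (Eventually.of_forall fun x => by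
    rw [Real.norm_eq_abs, abs_of_nonneg ((hφ n).2 x).1]; exact ((hφ n).2 x).2)

lemma power_nonneg {k : ℕ} {φ : ∀ n : ℕ, (Fin n → Sph k) → ℝ} (hφ : IsTestSeq φ) (κ : ℝ)
    (θ : Sph k) (n : ℕ) : 0 ≤ power φ κ θ n :=
  integral_nonneg fun x => ((hφ n).2 x).1

lemma power_le_one {k : ℕ} {φ : ∀ n : ℕ, (Fin n → Sph k) → ℝ} (hφ : IsTestSeq φ) (κ : ℝ)
    (θ : Sph k) (n : ℕ) : power φ κ θ n ≤ 1 :=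
  (integral_mono (integrable_test hφ κ θ n) (integrable_const 1) fun x => ((hφ n).2 x).2).trans
    (by simp)

lemma minPower_nonneg {k : ℕ} (κ₀ : ℝ) (Θ : Set (Sph k)) (b M : ℝ)
    {φ : ∀ n : ℕ, (Fin n → Sph k) → ℝ} (hφ : IsTestSeq φ) (n : ℕ) :
    0 ≤ minPower κ₀ Θ b M φ n := by
  refine Real.sInf_nonneg ?_
  rintro p ⟨θ, -, c, -, -, -, rfl⟩
  exact power_nonneg hφ _ _ _

lemma minPower_le {k : ℕ} {κ₀ : ℝ} {Θ : Set (Sph k)} {b M : ℝ}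
    {φ : ∀ n : ℕ, (Fin n → Sph k) → ℝ} (hφ : IsTestSeq φ) {n : ℕ} {θ : Sph k} (hθ : θ ∈ Θ)
    {c : ℝ} (hb : b ≤ |c|) (hM : |c| ≤ M) (hc : 0 < κ₀ + c / √n) :
    minPower κ₀ Θ b M φ n ≤ power φ (κ₀ + c / √n) θ n := by
  refine csInf_le ⟨0, ?_⟩ ⟨θ, hθ, c, hb, hM, hc, rfl⟩
  rintro p ⟨θ, -, c, -, -, -, rfl⟩
  exact power_nonneg hφ _ _ _

lemma le_minPower {k : ℕ} {κ₀ : ℝ} (hκ₀ : 0 < κ₀) {Θ : Set (Sph k)} (hΘ : Θ.Nonempty) {b M : ℝ}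
    (hb : 0 < b) (hbM : b ≤ M) {φ : ∀ n : ℕ, (Fin n → Sph k) → ℝ} {n : ℕ} {β : ℝ}
    (h : ∀ c ∈ {c : ℝ | b ≤ |c| ∧ |c| ≤ M}, ∀ θ ∈ Θ, β < power φ (κ₀ + c / √n) θ n) :
    β ≤ minPower κ₀ Θ b M φ n := by
  obtain ⟨θ, hθ⟩ := hΘ
  -- A real infimum over the empty set would be 0. The alternative `c = b` is admissible at every
  -- `n`, since `κ₀ + b/√n > 0`.
  refine le_csInf ⟨_, θ, hθ, b, (le_abs_self b), by rwa [abs_of_pos hb], by positivity, rfl⟩ ?_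
  rintro p ⟨θ', hθ', c, h1, h2, -, rfl⟩
  exact (h c ⟨h1, h2⟩ θ' hθ').le

lemma isTestSeq_scoreTest {k : ℕ} (κ₀ : ℝ) {est : ∀ n : ℕ, (Fin n → Sph k) → Sph k}
    (hmeas : ∀ n, Measurable (est n)) (α : ℝ) : IsTestSeq (scoreTest κ₀ est α) := by
  intro n
  refine ⟨measurable_const.indicator
    (measurableSet_lt measurable_const (measurable_scoreStat κ₀ hmeas n)), fun x => ?_⟩
  unfold scoreTest
  by_cases hx : x ∈ {x | upperQuantile (chiSqOne 0) α < scoreStat κ₀ est n x}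
  · rw [Set.indicator_of_mem hx]; simp
  · rw [Set.indicator_of_notMem hx]; simp

/-! ### Neyman-Pearson bound and the maximin property. -/

/-- The Neyman-Pearson inequality for an approximate likelihood ratio: `u e^{bS}` and `u' e^{-bS}`
are the likelihood ratios, with normalizations `u`, `u'` close to `r`. -/
lemma neymanPearson_pointwise {b s r u u' y p : ℝ} (hs : 0 ≤ s) (hr : 0 ≤ r) (hu : 0 ≤ u)
    (hu' : 0 ≤ u') (hp : p ∈ Set.Icc (0 : ℝ) 1) :
    ((Real.exp (b * y) * u + Real.exp (-b * y) * u') / 2 - r * Real.cosh (b * s)) *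
      (p - if s < |y| then 1 else 0) ≤ (|u - r| + |u' - r|) * Real.cosh (b * s) := by
  set e := |u - r| + |u' - r| with he
  set C := Real.cosh (b * s)
  set L := (Real.exp (b * y) * u + Real.exp (-b * y) * u') / 2
  have hC : 0 < C := Real.cosh_pos _
  have he0 : 0 ≤ e := by positivity
  have hx := Real.exp_pos (b * y)
  have hx' := Real.exp_pos (-b * y)
  have hch : Real.cosh (b * y) = (Real.exp (b * y) + Real.exp (-b * y)) / 2 := by
    rw [Real.cosh_eq, neg_mul]
  have h1 := abs_le.1 (le_refl |u - r|)
  have h2 := abs_le.1 (le_refl |u' - r|)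
  have ha := abs_nonneg (u - r)
  have ha' := abs_nonneg (u' - r)
  have hL1 : L ≤ (r + e) * Real.cosh (b * y) := by
    rw [hch]
    have i1 : Real.exp (b * y) * u ≤ Real.exp (b * y) * (r + e) :=
      mul_le_mul_of_nonneg_left (by linarith) hx.le
    have i2 : Real.exp (-b * y) * u' ≤ Real.exp (-b * y) * (r + e) :=
      mul_le_mul_of_nonneg_left (by linarith) hx'.le
    simp only [L]; linarith
  have hL2 : (r - e) * Real.cosh (b * y) ≤ L := by
    rw [hch]
    have i1 : Real.exp (b * y) * (r - e) ≤ Real.exp (b * y) * u :=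
      mul_le_mul_of_nonneg_left (by linarith) hx.le
    have i2 : Real.exp (-b * y) * (r - e) ≤ Real.exp (-b * y) * u' :=
      mul_le_mul_of_nonneg_left (by linarith) hx'.le
    simp only [L]; linarith
  have hL0 : 0 ≤ L := by positivity
  have hby : |b * y| = |b| * |y| := abs_mul _ _
  have hbs : |b * s| = |b| * s := by rw [abs_mul, abs_of_nonneg hs]
  split_ifs with hy
  · have hcc : C ≤ Real.cosh (b * y) := by
      rw [Real.cosh_le_cosh, hby, hbs]
      exact mul_le_mul_of_nonneg_left hy.le (abs_nonneg _)
    have h3 : r * C - L ≤ e * C := by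
      -- If `r < e`, the lower bound on `L` is vacuous, but then `r C ≤ e C` and `L ≥ 0` already
      -- suffice.
      rcases le_total 0 (r - e) with h | h
      · have := mul_le_mul_of_nonneg_left hcc h
        linarith
      · have := mul_le_mul_of_nonneg_right (sub_nonpos.1 h) hC.le
        linarith
    have h4 : 0 ≤ e * C := by positivity
    nlinarith [hp.1, hp.2]
  · have hcc : Real.cosh (b * y) ≤ C := by
      rw [Real.cosh_le_cosh, hby, hbs]
      exact mul_le_mul_of_nonneg_left (not_lt.1 hy) (abs_nonneg _)
    have h3 : L - r * C ≤ e * C := by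
      have := mul_le_mul_of_nonneg_left hcc (add_nonneg hr he0)
      linarith
    have h4 : 0 ≤ e * C := by positivity
    rw [sub_zero]
    nlinarith [hp.1, hp.2]

/-- The normalization of the likelihood ratio. -/
noncomputable def lrNorm {k : ℕ} (κ₀ c : ℝ) (θ : Sph k) (n : ℕ) : ℝ :=
  (∫ x, Real.exp (c * (score κ₀ θ n x / √n)) ∂(sampleLaw κ₀ θ n))⁻¹

lemma tendsto_lrNorm {k : ℕ} (hk : 2 ≤ k) {κ₀ : ℝ} (hκ₀ : κ₀ ≠ 0) (θ : Sph k) (c : ℝ) :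
    Tendsto (lrNorm κ₀ c θ) atTop (𝓝 (Real.exp (-(info k κ₀ * c ^ 2 / 2)))) := by
  rw [Real.exp_neg]
  exact (tendsto_integral_exp_score hk hκ₀ tendsto_id (fun _ => θ)
    (tendsto_const_nhds (x := c))).inv₀ (Real.exp_pos _).ne'

/-- The constant estimator turns the score test into the oracle test. Its threshold form in
`|S_n|/√n` feeds the Neyman-Pearson inequality, while the general theory still supplies its limiting
power. -/
lemma scoreTest_const {k : ℕ} (hk : 2 ≤ k) {κ₀ : ℝ} (hκ₀ : κ₀ ≠ 0) {α : ℝ} (h0 : 0 < α)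
    (h1 : α < 1) (θ : Sph k) (n : ℕ) (x : Fin n → Sph k) :
    scoreTest κ₀ (fun _ _ => θ) α n x =
      if √(upperQuantile (chiSqOne 0) α * info k κ₀) < |score κ₀ θ n x / √n| then 1 else 0 := by
  have hq := upperQuantile_chiSqOne_nonneg h0 h1
  have hi := info_pos hk hκ₀
  have : upperQuantile (chiSqOne 0) α < scoreStat κ₀ (fun _ _ => θ) n x ↔
      √(upperQuantile (chiSqOne 0) α * info k κ₀) < |score κ₀ θ n x / √n| := by
    rw [scoreStat_eq, lt_div_iff₀ hi, ← Real.sqrt_sq_eq_abs,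
      Real.sqrt_lt_sqrt_iff (mul_nonneg hq hi.le)]
  unfold scoreTest
  classical
  rw [Set.indicator_apply]
  simp only [Set.mem_ofPred_eq, this]

/-- Finite sample comparison of a test with the score test at known location, for the mixture of
two symmetric alternatives. -/
lemma power_mixture_le {k : ℕ} (hk : 2 ≤ k) {κ₀ : ℝ} (hκ₀ : κ₀ ≠ 0) {α : ℝ} (h0 : 0 < α)
    (h1 : α < 1) {ψ : ∀ n : ℕ, (Fin n → Sph k) → ℝ} (hψ : IsTestSeq ψ) (θ : Sph k) (b : ℝ) {r : ℝ}
    (hr : 0 ≤ r) (n : ℕ) :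
    (power ψ (κ₀ + b / √n) θ n + power ψ (κ₀ + -b / √n) θ n) / 2 ≤
      (power (scoreTest κ₀ (fun _ _ => θ) α) (κ₀ + b / √n) θ n +
        power (scoreTest κ₀ (fun _ _ => θ) α) (κ₀ + -b / √n) θ n) / 2 +
      (r * (power ψ κ₀ θ n - power (scoreTest κ₀ (fun _ _ => θ) α) κ₀ θ n) +
        (|lrNorm κ₀ b θ n - r| + |lrNorm κ₀ (-b) θ n - r|)) *
          Real.cosh (b * √(upperQuantile (chiSqOne 0) α * info k κ₀)) := by
  set φ := scoreTest κ₀ (fun _ _ => θ) α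
  have hφ : IsTestSeq φ := isTestSeq_scoreTest κ₀ (fun _ => measurable_const) α
  set C := Real.cosh (b * √(upperQuantile (chiSqOne 0) α * info k κ₀))
  set P := sampleLaw κ₀ θ n
  have hi : ∀ {χ : ∀ n : ℕ, (Fin n → Sph k) → ℝ}, IsTestSeq χ → ∀ c,
      Integrable (fun x => likelihoodRatio κ₀ c θ n x * χ n x) P := by
    intro χ hχ c
    exact (integrable_sampleLaw_of_continuous _ _ _ (continuous_likelihoodRatio κ₀ c θ n)).mul_bdd (c := 1)
      (hχ n).1.aestronglyMeasurable (Eventually.of_forall fun x => by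
        rw [Real.norm_eq_abs, abs_of_nonneg ((hχ n).2 x).1]; exact ((hχ n).2 x).2)
  have hpow : ∀ (χ : ∀ n : ℕ, (Fin n → Sph k) → ℝ) c,
      power χ (κ₀ + c / √n) θ n = ∫ x, likelihoodRatio κ₀ c θ n x * χ n x ∂P := fun χ c =>
    integral_sampleLaw_local κ₀ c θ n (χ n)
  have hdec : ∀ {χ : ∀ n : ℕ, (Fin n → Sph k) → ℝ}, IsTestSeq χ →
      ∫ x, ((likelihoodRatio κ₀ b θ n x + likelihoodRatio κ₀ (-b) θ n x) / 2 - r * C) * χ n x ∂P =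
        (power χ (κ₀ + b / √n) θ n + power χ (κ₀ + -b / √n) θ n) / 2 -
          r * C * power χ κ₀ θ n := by
    intro χ hχ
    have hi2 : Integrable (fun x => (likelihoodRatio κ₀ b θ n x * χ n x +
        likelihoodRatio κ₀ (-b) θ n x * χ n x) / 2) P :=
      ((hi hχ b).add (hi hχ (-b))).div_const 2
    rw [hpow, hpow, power, ← integral_add (hi hχ b) (hi hχ (-b)), ← integral_div,
      ← integral_const_mul, ← integral_sub hi2 ((integrable_test hχ κ₀ θ n).const_mul _)]
    refine integral_congr_ae (Eventually.of_forall fun x => ?_)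
    simp only
    ring
  have hdi : ∀ {χ : ∀ n : ℕ, (Fin n → Sph k) → ℝ}, IsTestSeq χ → Integrable (fun x =>
      ((likelihoodRatio κ₀ b θ n x + likelihoodRatio κ₀ (-b) θ n x) / 2 - r * C) * χ n x) P := by
    intro χ hχ
    refine ((((hi hχ b).add (hi hχ (-b))).div_const 2).sub
      ((integrable_test hχ κ₀ θ n).const_mul (r * C))).congr (Eventually.of_forall fun x => ?_)
    simp only [Pi.add_apply, Pi.sub_apply]
    ring
  have key : ∫ x, ((likelihoodRatio κ₀ b θ n x + likelihoodRatio κ₀ (-b) θ n x) / 2 - r * C) *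
      ψ n x ∂P - ∫ x, ((likelihoodRatio κ₀ b θ n x + likelihoodRatio κ₀ (-b) θ n x) / 2 - r * C) *
      φ n x ∂P ≤ (|lrNorm κ₀ b θ n - r| + |lrNorm κ₀ (-b) θ n - r|) * C := by
    rw [← integral_sub (hdi hψ) (hdi hφ)]
    refine (integral_mono ((hdi hψ).sub (hdi hφ)) (integrable_const _) fun x => ?_).trans
      (b := ∫ x, (|lrNorm κ₀ b θ n - r| + |lrNorm κ₀ (-b) θ n - r|) * C ∂P) (by simp [P])
    have hn0 : ∀ c, 0 ≤ lrNorm κ₀ c θ n := fun c =>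
      inv_nonneg.2 (integral_nonneg fun _ => (Real.exp_pos _).le)
    have := neymanPearson_pointwise (b := b) (y := score κ₀ θ n x / √n) (p := ψ n x)
      (Real.sqrt_nonneg (upperQuantile (chiSqOne 0) α * info k κ₀)) hr (hn0 b) (hn0 (-b))
      ((hψ n).2 x)
    rw [← scoreTest_const hk hκ₀ h0 h1, mul_sub] at this
    exact this
  rw [hdec hψ, hdec hφ] at key
  linarith

lemma rootNConsistentOn_const {k : ℕ} (κ₀ : ℝ) (θ : Sph k) :
    RootNConsistentOn κ₀ {θ} fun _ _ => θ := by
  intro ε hε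
  refine ⟨0, Eventually.of_forall fun n τ hτ => ?_⟩
  rw [Set.mem_singleton_iff.1 hτ]
  simpa using hε.le

lemma tendsto_power_const {k : ℕ} (hk : 2 ≤ k) {κ₀ : ℝ} (hκ₀ : κ₀ ≠ 0) (α : ℝ) (θ : Sph k)
    (c : ℝ) : Tendsto (fun n : ℕ => power (scoreTest κ₀ (fun _ _ => θ) α) (κ₀ + c / √n) θ n) atTop
      (𝓝 (limitPower k κ₀ α c)) :=
  tendsto_power_scoreTest_seq hk hκ₀ (fun _ => measurable_const) (rootNConsistentOn_const κ₀ θ) α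
    tendsto_id (fun _ => Set.mem_singleton θ) tendsto_const_nhds

/-- The asymptotic minimum power of any test of asymptotic level `α` is at most the limiting power
of the score test at the boundary of the alternative. -/
lemma eventually_minPower_le {k : ℕ} (hk : 2 ≤ k) {κ₀ : ℝ} (hκ₀ : 0 < κ₀) {α : ℝ} (h0 : 0 < α)
    (h1 : α < 1) {Θ : Set (Sph k)} (hΘ : Θ.Nonempty) {b M : ℝ} (hb : 0 < b) (hbM : b ≤ M)
    {ψ : ∀ n : ℕ, (Fin n → Sph k) → ℝ} (hψ : HasAsympLevelLE κ₀ Θ α ψ) {ε : ℝ} (hε : 0 < ε) :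
    ∀ᶠ n in atTop, minPower κ₀ Θ b M ψ n ≤ limitPower k κ₀ α b + ε := by
  obtain ⟨θ, hθ⟩ := hΘ
  let C := Real.cosh (b * √(upperQuantile (chiSqOne 0) α * info k κ₀))
  -- The common limit of the likelihood ratio normalizations at `b` and `-b`. With it the error
  -- terms vanish, and an excess `δ` of level costs `r * δ * C = ε/2` of power.
  let r := Real.exp (-(info k κ₀ * b ^ 2 / 2))
  have hC : 0 < C := Real.cosh_pos _
  have hr : 0 < r := Real.exp_pos _
  let δ := ε / (2 * (r * C))
  have hδ : 0 < δ := by positivity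
  have t1 := tendsto_power_const hk hκ₀.ne' α θ b
  have t2 := tendsto_power_const hk hκ₀.ne' α θ (-b)
  have t3 := tendsto_power_const hk hκ₀.ne' α θ 0
  have e2 : limitPower k κ₀ α (-b) = limitPower k κ₀ α b := by simp [limitPower]
  simp only [zero_div, add_zero, limitPower_zero h0 h1] at t3
  rw [e2] at t2
  have t4 := tendsto_lrNorm hk hκ₀.ne' θ b
  have t5 := tendsto_lrNorm hk hκ₀.ne' θ (-b)
  rw [neg_sq] at t5
  have t6 := ((t4.sub_const r).abs).add ((t5.sub_const r).abs)
  have t7 := ((t1.add t2).div_const 2).add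
    ((((t3.const_sub (α + δ)).const_mul r).add t6).mul_const C)
  have e3 : (limitPower k κ₀ α b + limitPower k κ₀ α b) / 2 +
      (r * (α + δ - α) + (|Real.exp (-(info k κ₀ * b ^ 2 / 2)) - r| +
        |Real.exp (-(info k κ₀ * b ^ 2 / 2)) - r|)) * C = limitPower k κ₀ α b + ε / 2 := by
    have : r * δ * C = ε / 2 := by simp only [δ]; field_simp
    simp only [r, sub_self, abs_zero, add_zero, add_sub_cancel_left] at this ⊢
    linarith
  rw [e3] at t7
  have hpos : ∀ᶠ n : ℕ in atTop, 0 < κ₀ + -b / √(n : ℝ) := by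
    have : Tendsto (fun n : ℕ => κ₀ + -b / √(n : ℝ)) atTop (𝓝 (κ₀ + 0)) :=
      (Tendsto.div_atTop tendsto_const_nhds
        (Real.tendsto_sqrt_atTop.comp tendsto_natCast_atTop_atTop)).const_add _
    rw [add_zero] at this
    exact this.eventually_const_lt hκ₀
  filter_upwards [t7.eventually_lt_const (show _ < limitPower k κ₀ α b + ε by linarith),
    hψ.2 δ hδ, hpos] with n hn hlev hp
  have m1 := minPower_le (M := M) (b := b) hψ.1 hθ (c := b) (n := n) (κ₀ := κ₀) (le_abs_self b)
    (by rwa [abs_of_pos hb]) (by positivity)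
  have m2 := minPower_le (M := M) (b := b) hψ.1 hθ (c := -b) (n := n) (κ₀ := κ₀)
    (by rw [abs_neg]; exact le_abs_self b) (by rwa [abs_neg, abs_of_pos hb]) hp
  have m3 := power_mixture_le hk hκ₀.ne' h0 h1 hψ.1 θ b hr.le n
  have m4 := hlev θ hθ
  have m5 : (r * (power ψ κ₀ θ n - power (scoreTest κ₀ (fun _ _ => θ) α) κ₀ θ n) +
        (|lrNorm κ₀ b θ n - r| + |lrNorm κ₀ (-b) θ n - r|)) * C ≤
      (r * (α + δ - power (scoreTest κ₀ (fun _ _ => θ) α) κ₀ θ n) +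
        (|lrNorm κ₀ b θ n - r| + |lrNorm κ₀ (-b) θ n - r|)) * C := by gcongr
  change _ ≤ _ + _ * C at m3
  linarith

lemma isLocAsympMaximin_scoreTest {k : ℕ} (hk : 2 ≤ k) {κ₀ : ℝ} (hκ₀ : 0 < κ₀)
    {est : ∀ n : ℕ, (Fin n → Sph k) → Sph k} (hmeas : ∀ n, Measurable (est n)) {Θ : Set (Sph k)}
    (hΘ : Θ.Nonempty) (hest : RootNConsistentOn κ₀ Θ est) {α : ℝ} (h0 : 0 < α) (h1 : α < 1) :
    IsLocAsympMaximin κ₀ Θ α (scoreTest κ₀ est α) := by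
  have hφ := isTestSeq_scoreTest κ₀ hmeas α
  refine ⟨hφ, fun ε hε => ?_, fun b M hb hbM ψ hψ => ?_⟩
  · have h2 := tendsto_power_scoreTest hk hκ₀.ne' hmeas hest α 0
    rw [limitPower_zero h0 h1] at h2
    obtain ⟨pa, hpa, pb, hpb, h⟩ := eventually_prod_iff.1
      (h2.eventually (Metric.closedBall_mem_nhds α hε))
    -- The level is the power at `c = 0`, extracted from the neighbourhood by `self_of_nhds`.
    filter_upwards [hpa.curry] with n hn θ hθ
    have h3 := h hn.self_of_nhds (eventually_top.1 hpb ⟨θ, hθ⟩)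
    simpa [Real.dist_eq] using h3
  · have hK : IsCompact {c : ℝ | b ≤ |c| ∧ |c| ≤ M} := by
      refine (isCompact_Icc (a := -M) (b := M)).of_isClosed_subset
        ((isClosed_le continuous_const continuous_abs).inter
          (isClosed_le continuous_abs continuous_const)) fun c hc => abs_le.1 hc.2
    refine le_of_forall_pos_le_add fun ε hε => ?_
    have hup : limsup (minPower κ₀ Θ b M ψ) atTop ≤ limitPower k κ₀ α b + ε / 2 :=
      -- In `ℝ` these limits are only meaningful for bounded sequences; the bounds 0 and, below, 1
      -- on powers provide this.
      limsup_le_of_le (isBoundedUnder_of (r := (· ≥ ·))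
        ⟨0, minPower_nonneg κ₀ Θ b M hψ.1⟩).isCoboundedUnder_le
        (eventually_minPower_le hk hκ₀ h0 h1 hΘ hb hbM hψ (by positivity))
    have hlow : limitPower k κ₀ α b - ε / 2 ≤ liminf (minPower κ₀ Θ b M (scoreTest κ₀ est α))
        atTop := by
      refine le_liminf_of_le (isBoundedUnder_of (r := (· ≤ ·))
        ⟨1, fun n => ?_⟩).isCoboundedUnder_ge ?_
      · obtain ⟨θ, hθ⟩ := hΘ
        exact (minPower_le hφ hθ (le_abs_self b) (by rwa [abs_of_pos hb])
          (by positivity)).trans (power_le_one hφ _ _ _)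
      · filter_upwards [eventually_power_scoreTest hk hκ₀.ne' hmeas hest α hK
          (β := limitPower k κ₀ α b - ε / 2) fun c hc =>
          (by linarith : limitPower k κ₀ α b - ε / 2 < limitPower k κ₀ α b).trans_le
            (limitPower_mono hk hκ₀.ne' h0 h1 hb.le hc.1)] with n hn
        exact le_minPower hκ₀ hΘ hb hbM hn
    linarith

end FvML

theorem mainTheorem2 (k : ℕ) (hk : 2 ≤ k) (κ₀ : ℝ) (hκ₀ : 0 < κ₀)
    (est : ∀ n : ℕ, (Fin n → FvML.Sph k) → FvML.Sph k) (hmeas : ∀ n, Measurable (est n))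
    (hest : ∀ θ : FvML.Sph k, FvML.RootNConsistentOn κ₀ {θ} est) :
    -- (i) the null distribution
    (∀ θ : FvML.Sph k,
      TendstoInDistribution (FvML.scoreStat κ₀ est) atTop id
        (FvML.sampleLaw κ₀ θ) (FvML.chiSqOne 0)) ∧
    -- (ii) the distribution under local alternatives
    (∀ (θ : FvML.Sph k) (c : ℕ → ℝ) (cLim : ℝ), (∀ n : ℕ, 0 < κ₀ + c n / √n) →
      Tendsto c atTop (𝓝 cLim) →
      TendstoInDistribution (FvML.scoreStat κ₀ est) atTop id
        (fun n => FvML.sampleLaw (κ₀ + c n / √n) θ n)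
        (FvML.chiSqOne ((1 - ((k : ℝ) - 1) / κ₀ * FvML.A k κ₀ - FvML.A k κ₀ ^ 2) * cLim ^ 2))) ∧
    -- (iii) level and optimality of the test, at each location, and uniformly over all locations
    -- if the root-n consistency is uniform
    (∀ α : ℝ, 0 < α → α < 1 →
      (∀ θ : FvML.Sph k,
        FvML.IsLocAsympMaximin κ₀ {θ} α (FvML.scoreTest κ₀ est α)) ∧
      (FvML.RootNConsistentOn κ₀ Set.univ est →
        FvML.IsLocAsympMaximin κ₀ Set.univ α (FvML.scoreTest κ₀ est α))) := by
  have hloc : ∀ (θ : FvML.Sph k) (c : ℕ → ℝ) (cLim : ℝ), Tendsto c atTop (𝓝 cLim) →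
      TendstoInDistribution (FvML.scoreStat κ₀ est) atTop id
        (fun n => FvML.sampleLaw (κ₀ + c n / √n) θ n)
        (FvML.chiSqOne (FvML.info k κ₀ * cLim ^ 2)) := fun θ c cLim hc =>
    FvML.tendstoInDistribution_scoreStat hk hκ₀.ne' hmeas (hest θ) tendsto_id
      (fun _ => Set.mem_singleton θ) hc
  refine ⟨fun θ => ?_, fun θ c cLim _ hc => hloc θ c cLim hc, fun α h0 h1 => ⟨fun θ => ?_,
    fun hu => ?_⟩⟩
  · have h := hloc θ (fun _ => 0) 0 tendsto_const_nhds
    simpa using h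
  · exact FvML.isLocAsympMaximin_scoreTest hk hκ₀ hmeas (Set.singleton_nonempty θ) (hest θ) h0 h1
  · have := FvML.nonempty_sphere hk
    exact FvML.isLocAsympMaximin_scoreTest hk hκ₀ hmeas Set.univ_nonempty hu h0 h1
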